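/- Let $n\ge 1$ and let $M$ be a smooth manifold of dimension $4n$. Let $\mathbb H^n$ be the space of quaternionic row vectors and let $\mathrm{Sp}(1)\mathrm{GL}(n,\mathbb H)\subset \mathrm{GL}(4n,\mathbb R)$ be the group of maps $v\mapsto qvA$ with $q$ a unit quaternion and $A\in \mathrm{GL}(n,\mathbb H)$. Let $Q$ be an $\mathrm{Sp}(1)\mathrm{GL}(n,\mathbb H)$-structure on $M$, that is, a smooth principal subbundle with this structure group of the bundle of frames $T_xM\cong\mathbb H^n$. If $n\ge 2$, assume that $M$ is a quaternionic manifold, i.e. that $Q$ admits a torsion-free connection: there is a smooth torsion-free linear connection $\nabla$ on $TM$ whose connection form in every local section of $Q$ takes values in the Lie algebra $\mathfrak{sp}(1)+\mathfrak{gl}(n,\mathbb H)$. (If $n=1$, $Q$ is an oriented conformal structure and nothing more is assumed; in particular self-dual conformal $4$-manifolds are included.) A frame $p\in Q_x$ makes $\mathrm{Sp}(1)$ act on $T_xM$ by left multiplication, and hence on the complex-valued $k$-forms at $x$ by $(q\alpha)(v_1,\dots,v_k)=\alpha(q^{-1}v_1,\dots,q^{-1}v_k)$. For $r\in\mathbb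 Z$ let $(E_{k,r})_x\subseteq\Lambda^kT_x^*M\otimes\mathbb C$ be the sum of all irreducible complex $\mathrm{Sp}(1)$-subrepresentations of highest weight $r$ (weights taken with respect to $\mathrm U(1)=\{e^{i\theta}\}\subset \mathrm{Sp}(1)$); this does not depend on $p$, and it is $0$ for $r<0$. For real-valued forms, $(E_{k,r})_x$ consists of the real $k$-forms whose complexification lies in this subspace. Then, for all $k\ge0$ and all $r$, both for complex-valued and for real-valued forms, the subspaces $(E_{k+1,r+1})_x$ and $(E_{k+1,r-1})_x$ intersect trivially at every point $x$, and the exterior derivative $d$ maps $C^\infty(M,E_{k,r})$ into $C^\infty(M,E_{k+1,r+1}\oplus E_{k+1,r-1})$: if $\alpha$ is a smooth $k$-form with $\alpha_x\in (E_{k,r})_x$ for all $x\in M$, then $d\alpha$ is a smooth $(k+1)$-form with $(d\alpha)_x\in (E_{k+1,r+1})_x\oplus (E_{k+1,r-1})_x$ for all $x\in M$. -/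

import Mathlib

open scoped Manifold ContDiff Quaternion Bundle
open Set

namespace QuatDolbeault

noncomputable section

/-! ### The group `Sp(1) GL(n, ℍ)` and its Lie algebra, acting on `ℍⁿ` -/

/-- `Sp(1)`: the group of unit quaternions. -/
abbrev Sp1 : Type := unitary ℍ[ℝ]

/-- Left multiplication by a quaternion on the space `ℍⁿ` of row vectors. -/
def leftMul (n : ℕ) (q : ℍ[ℝ]) : (Fin n → ℍ[ℝ]) →L[ℝ] (Fin n → ℍ[ℝ]) :=
  LinearMap.toContinuousLinearMap
    { toFun := fun v i => q * v i
      map_add' := fun v w => by ext1 i; simp [mul_add]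
      map_smul' := fun c v => by ext1 i; simp }

/-- The subset `Sp(1) GL(n, ℍ)` of `GL(4n, ℝ)`: the maps `v ↦ q v A` with `q` a unit quaternion and
`A` an invertible quaternionic matrix acting on row vectors from the right. -/
def sp1GL (n : ℕ) : Set ((Fin n → ℍ[ℝ]) ≃L[ℝ] (Fin n → ℍ[ℝ])) :=
  {g | ∃ (q : Sp1) (A : GL (Fin n) ℍ[ℝ]),
    ∀ v, g v = leftMul n (q : ℍ[ℝ]) (Matrix.vecMul v (A : Matrix (Fin n) (Fin n) ℍ[ℝ]))}

/-- The Lie algebra `𝔰𝔭(1) + 𝔤𝔩(n, ℍ)` inside the endomorphisms of `ℍⁿ`: the maps `v ↦ a v + v B` with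
`a` an imaginary quaternion and `B` a quaternionic matrix. -/
def sp1glAlgebra (n : ℕ) : Set ((Fin n → ℍ[ℝ]) → (Fin n → ℍ[ℝ])) :=
  {f | ∃ (a : ℍ[ℝ]) (B : Matrix (Fin n) (Fin n) ℍ[ℝ]), a.re = 0 ∧
    ∀ v, f v = leftMul n a v + Matrix.vecMul v B}

/-! ### Representations of `Sp(1)` and highest weights -/

/-- The quaternion `exp(iθ) = cos θ + i sin θ`. -/
def expIQuat (θ : ℝ) : ℍ[ℝ] := ⟨Real.cos θ, Real.sin θ, 0, 0⟩

theorem expIQuat_mem (θ : ℝ) : expIQuat θ ∈ unitary ℍ[ℝ] := by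
  have h := Real.sin_sq_add_cos_sq θ
  have h0 : (expIQuat θ).re = Real.cos θ := rfl
  have h1 : (expIQuat θ).imI = Real.sin θ := rfl
  have h2 : (expIQuat θ).imJ = 0 := rfl
  have h3 : (expIQuat θ).imK = 0 := rfl
  refine Unitary.mem_iff.mpr ⟨?_, ?_⟩ <;> ext <;> simp [h0, h1, h2, h3] <;> nlinarith

/-- The element `exp(iθ)` of the subgroup `U(1) ⊆ Sp(1)`. -/
def expI (θ : ℝ) : Sp1 := ⟨expIQuat θ, expIQuat_mem θ⟩

/-- The integer `m` is a weight of the complex representation `ρ` of `Sp(1)`: there is a nonzero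
vector on which `exp(iθ) ∈ U(1)` acts as `exp(imθ)`. -/
def HasWeight {W : Type*} [AddCommMonoid W] [Module ℂ W] (ρ : Representation ℂ Sp1 W) (m : ℤ) :
    Prop :=
  ∃ w : W, w ≠ 0 ∧ ∀ θ : ℝ, ρ (expI θ) w = Complex.exp (Complex.I * m * θ) • w

/-- The largest weight of `ρ` is `r`. -/
def HasHighestWeight {W : Type*} [AddCommMonoid W] [Module ℂ W] (ρ : Representation ℂ Sp1 W)
    (r : ℤ) : Prop :=
  HasWeight ρ r ∧ ∀ m : ℤ, HasWeight ρ m → m ≤ r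

section Fibre

variable {V : Type*} [AddCommGroup V] [Module ℝ V] [TopologicalSpace V] {n : ℕ}

/-- The action of a quaternion on `V` obtained from an isomorphism `p : V ≅ ℍⁿ`. -/
def quatAct (p : V ≃L[ℝ] (Fin n → ℍ[ℝ])) (q : ℍ[ℝ]) : V →L[ℝ] V :=
  (p.symm : (Fin n → ℍ[ℝ]) →L[ℝ] V) ∘L leftMul n q ∘L (p : V →L[ℝ] (Fin n → ℍ[ℝ]))

/-- The representation of `Sp(1)` on complex-valued alternating `k`-forms on `V` obtained from an
isomorphism `p : V ≅ ℍⁿ`: `(q α)(v₁, …, v_k) = α(q⁻¹ v₁, …, q⁻¹ v_k)`. -/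
def formRep (p : V ≃L[ℝ] (Fin n → ℍ[ℝ])) (k : ℕ) :
    Representation ℂ Sp1 (V [⋀^Fin k]→L[ℝ] ℂ) where
  toFun q :=
    { toFun := fun α => α.compContinuousLinearMap (quatAct p ((q⁻¹ : Sp1) : ℍ[ℝ]))
      map_add' := fun _ _ => rfl
      map_smul' := fun _ _ => rfl }
  map_one' := by
    ext α v
    simp [quatAct, leftMul, Function.comp_def]
  map_mul' q₁ q₂ := by
    ext α v
    simp [quatAct, leftMul, Function.comp_def, mul_assoc]

/-- The sum of all irreducible `Sp(1)`-subrepresentations of highest weight `r` in the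
complex-valued `k`-forms on `V`, where the `Sp(1)`-action comes from `p : V ≅ ℍⁿ`. -/
def weightForms (p : V ≃L[ℝ] (Fin n → ℍ[ℝ])) (k : ℕ) (r : ℤ) :
    Submodule ℂ (V [⋀^Fin k]→L[ℝ] ℂ) :=
  ⨆ (W : Subrepresentation (formRep p k)) (_ : Representation.IsIrreducible (k := ℂ) (V := W.toSubmodule) W.toRepresentation)
    (_ : HasHighestWeight W.toRepresentation r), W.toSubmodule

/-- The complexification of real-valued `k`-forms, as a real-linear map. -/
def complexify (V : Type*) [AddCommGroup V] [Module ℝ V] [TopologicalSpace V] (k : ℕ) :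
    (V [⋀^Fin k]→L[ℝ] ℝ) →ₗ[ℝ] (V [⋀^Fin k]→L[ℝ] ℂ) where
  toFun α := Complex.ofRealCLM.compContinuousAlternatingMap α
  map_add' α β := by ext v; simp
  map_smul' c α := by ext v; simp

end Fibre

/-! ### Differential forms on a manifold -/

section Forms

variable {E : Type*} [NormedAddCommGroup E] [NormedSpace ℝ E]
  {M : Type*} [TopologicalSpace M] [ChartedSpace E M]
  {F : Type*} [NormedAddCommGroup F] [NormedSpace ℝ F] {k : ℕ}

/-- A (not necessarily smooth) `F`-valued differential `k`-form on `M`. -/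
abbrev DForm (E : Type*) [NormedAddCommGroup E] [NormedSpace ℝ E]
    (M : Type*) [TopologicalSpace M] [ChartedSpace E M]
    (F : Type*) [NormedAddCommGroup F] [NormedSpace ℝ F] (k : ℕ) :=
  ∀ x : M, TangentSpace 𝓘(ℝ, E) x [⋀^Fin k]→L[ℝ] F

/-- The expression of a form in the chart around `x₀`, that is, its pullback under the inverse of
that chart. It is meaningful on the target of the chart. -/
def DForm.inChart (α : DForm E M F k) (x₀ : M) : E → E [⋀^Fin k]→L[ℝ] F := fun y =>
  (α ((extChartAt 𝓘(ℝ, E) x₀).symm y)).compContinuousLinearMap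
    (mfderiv 𝓘(ℝ, E) 𝓘(ℝ, E) (extChartAt 𝓘(ℝ, E) x₀).symm y)

/-- A form is smooth if its expressions in the charts are smooth. -/
def DForm.IsSmooth (α : DForm E M F k) : Prop :=
  ∀ x₀ : M, ContDiffOn ℝ ∞ (α.inChart x₀) (extChartAt 𝓘(ℝ, E) x₀).target

/-- The exterior derivative on `M`, computed at `x` in the chart around `x`. -/
def DForm.d (α : DForm E M F k) : DForm E M F (k + 1) := fun x =>
  (extDeriv (α.inChart x) (extChartAt 𝓘(ℝ, E) x x)).compContinuousLinearMap
    (mfderiv 𝓘(ℝ, E) 𝓘(ℝ, E) (extChartAt 𝓘(ℝ, E) x) x)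

/-- The smooth sections of a family `S` of subspaces of the spaces of `k`-forms. -/
def smoothSections {R : Type*} [Semiring R] [Module R F] [ContinuousConstSMul R F]
    [SMulCommClass ℝ R F]
    (S : ∀ x : M, Submodule R (TangentSpace 𝓘(ℝ, E) x [⋀^Fin k]→L[ℝ] F)) :
    Set (DForm E M F k) :=
  {α | α.IsSmooth ∧ ∀ x, α x ∈ S x}

end Forms

/-! ### `Sp(1) GL(n, ℍ)`-structures and torsion-free connections -/

section Structures

variable {E : Type*} [NormedAddCommGroup E] [NormedSpace ℝ E]
  {M : Type*} [TopologicalSpace M] [ChartedSpace E M] {n : ℕ}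

/-- A choice of a frame `T_xM ≅ ℍⁿ` at each point is smooth on `U` if the vector fields
corresponding to the constant vectors of `ℍⁿ` are smooth on `U`. -/
def IsSmoothFrameOn [IsManifold 𝓘(ℝ, E) 1 M]
    (s : ∀ x : M, TangentSpace 𝓘(ℝ, E) x ≃L[ℝ] (Fin n → ℍ[ℝ])) (U : Set M) : Prop :=
  ∀ v : Fin n → ℍ[ℝ], ContMDiffOn 𝓘(ℝ, E) 𝓘(ℝ, E).tangent ∞
    (fun x => (⟨x, (s x).symm v⟩ : TangentBundle 𝓘(ℝ, E) M)) U

/-- An `Sp(1) GL(n, ℍ)`-structure on `M`: a principal subbundle with this structure group of the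
bundle of frames `T_xM ≅ ℍⁿ`. -/
structure Sp1GLStructure (E : Type*) [NormedAddCommGroup E] [NormedSpace ℝ E]
    (M : Type*) [TopologicalSpace M] [ChartedSpace E M] [IsManifold 𝓘(ℝ, E) 1 M] (n : ℕ) where
  /-- The frames at `x` that belong to the structure. -/
  frames : ∀ x : M, Set (TangentSpace 𝓘(ℝ, E) x ≃L[ℝ] (Fin n → ℍ[ℝ]))
  /-- Each fibre is a single orbit of the group. -/
  mem_iff : ∀ (x : M), ∀ p ∈ frames x, ∀ p' : TangentSpace 𝓘(ℝ, E) x ≃L[ℝ] (Fin n → ℍ[ℝ]),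
    p' ∈ frames x ↔ ∃ g ∈ sp1GL n, p' = p.trans g
  /-- There are smooth local sections around every point. -/
  exists_section : ∀ x₀ : M, ∃ (U : Set M)
    (s : ∀ x : M, TangentSpace 𝓘(ℝ, E) x ≃L[ℝ] (Fin n → ℍ[ℝ])),
    IsOpen U ∧ x₀ ∈ U ∧ (∀ x ∈ U, s x ∈ frames x) ∧ IsSmoothFrameOn s U

/-- The linear connection `∇` preserves the structure `Q`: in every smooth local section `s` of `Q`
the connection form of `∇` takes values in the Lie algebra of `Sp(1) GL(n, ℍ)`. -/
def Preserves [IsManifold 𝓘(ℝ, E) 1 M] (Q : Sp1GLStructure E M n)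
    (cov : CovariantDerivative 𝓘(ℝ, E) E (TangentSpace 𝓘(ℝ, E) : M → Type _)) : Prop :=
  ∀ (U : Set M) (s : ∀ x : M, TangentSpace 𝓘(ℝ, E) x ≃L[ℝ] (Fin n → ℍ[ℝ])),
    IsOpen U → (∀ x ∈ U, s x ∈ Q.frames x) → IsSmoothFrameOn s U →
    ∀ x ∈ U, ∀ X : TangentSpace 𝓘(ℝ, E) x,
      (fun v => s x (cov (fun y => (s y).symm v) x X)) ∈ sp1glAlgebra n

/-- `Q` admits a (smooth) torsion-free connection. -/
def AdmitsTorsionFreeConnection [FiniteDimensional ℝ E] [CompleteSpace E]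
    [IsManifold 𝓘(ℝ, E) ∞ M] (Q : Sp1GLStructure E M n) : Prop :=
  ∃ cov : CovariantDerivative 𝓘(ℝ, E) E (TangentSpace 𝓘(ℝ, E) : M → Type _),
    CovariantDerivative.ContMDiffCovariantDerivative cov ∞ ∧ cov.torsion = 0 ∧ Preserves Q cov

/-- The fibre at `x` of the bundle `E_{k,r}` of complex-valued forms: the forms lying in
`Sp(1)`-representations of highest weight `r`. The `Sp(1)`-action depends on a frame in `Q`;
the resulting subspace does not. -/
def bundleC [IsManifold 𝓘(ℝ, E) 1 M] (Q : Sp1GLStructure E M n) (k : ℕ) (r : ℤ) (x : M) :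
    Submodule ℂ (TangentSpace 𝓘(ℝ, E) x [⋀^Fin k]→L[ℝ] ℂ) :=
  ⨆ p ∈ Q.frames x, weightForms p k r

/-- The fibre at `x` of the bundle `E_{k,r}` of real-valued forms: the forms whose complexification
lies in Sp(1)-representations of highest weight `r`. -/
def bundleR [IsManifold 𝓘(ℝ, E) 1 M] (Q : Sp1GLStructure E M n) (k : ℕ) (r : ℤ) (x : M) :
    Submodule ℝ (TangentSpace 𝓘(ℝ, E) x [⋀^Fin k]→L[ℝ] ℝ) :=
  ((bundleC Q k r x).restrictScalars ℝ).comap (complexify (TangentSpace 𝓘(ℝ, E) x) k)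

end Structures

end

end QuatDolbeault

/-!
Left multiplication by imaginary quaternions makes `𝔰𝔭(1)` act on forms, and on `E_{k,r}` the
Casimir operator of this action is multiplication by `r (r + 2)`; for `r ≥ -1` the eigenspace is
exactly `E_{k,r}`. Since the eigenvalues are real, this describes real and complex forms alike, and
makes the eigenspaces stable under `𝔰𝔭(1) + 𝔤𝔩(n, ℍ)`.

In a local frame of `Q`, a torsion-free connection with values in that Lie algebra writes `dα` as
the alternation of a map `w ↦ ∇_w α` whose values again lie in the `r`-eigenspace. On the tangent
space `i² = -1`, so it is a sum of two-dimensional representations, and the Clebsch–Gordan rule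
`V_1 ⊗ V_r = V_{r+1} ⊕ V_{r-1}` puts `dα` in `E_{k+1,r+1} ⊕ E_{k+1,r-1}`. The rule is used in the
form of a quadratic equation for the part of the Casimir operator that mixes the two factors.

For `n = 1` no connection is needed: in dimension four, so few types occur in each degree that
`E_{k+1,r+1} ⊕ E_{k+1,r-1}` is all of `Λ^{k+1}` as soon as `E_{k,r}` is nonzero.
-/

namespace QuatDolbeault

noncomputable section

open ContinuousAlternatingMap (alternatizeUncurryFin alternatizeUncurryFin_apply
  alternatizeUncurryFin_add alternatizeUncurryFin_smul)

/-! ### The derivation action of endomorphisms on forms -/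

section Derivation

variable {𝕜 : Type*} [NontriviallyNormedField 𝕜]
  {V : Type*} [NormedAddCommGroup V] [NormedSpace 𝕜 V]
  {W : Type*} [NormedAddCommGroup W] [NormedSpace 𝕜 W]
  {F : Type*} [NormedAddCommGroup F] [NormedSpace 𝕜 F]
  {G : Type*} [NormedAddCommGroup G] [NormedSpace 𝕜 G]
  {ι : Type*} [Fintype ι] [DecidableEq ι] {k : ℕ}

/-- The infinitesimal action of an endomorphism `A` on forms, that is, minus the derivative at the
identity of `g ↦ g^* α` in the direction `A`. The sign makes it an action of the Lie algebra of
endomorphisms. -/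
def lieDer : (V →L[𝕜] V) →ₗ[𝕜] (V [⋀^ι]→L[𝕜] F) →L[𝕜] (V [⋀^ι]→L[𝕜] F) :=
  -(ContinuousAlternatingMap.fderivCompContinuousLinearMapCLM F (.id 𝕜 V)).flip.toLinearMap

theorem lieDer_eq (A : V →L[𝕜] V) (α : V [⋀^ι]→L[𝕜] F) :
    lieDer A α = -α.fderivCompContinuousLinearMap (.id 𝕜 V) A := rfl

theorem lieDer_apply (A : V →L[𝕜] V) (α : V [⋀^ι]→L[𝕜] F) (v : ι → V) :
    lieDer A α v = -∑ i, α (Function.update v i (A (v i))) := by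
  rw [lieDer_eq, ContinuousAlternatingMap.neg_apply,
    ContinuousAlternatingMap.fderivCompContinuousLinearMap_apply]
  congr 1
  refine Finset.sum_congr rfl fun i _ => congrArg α (funext fun j => ?_)
  rcases eq_or_ne j i with rfl | h <;> simp [*]

theorem lieDer_lieDer_apply (A B : V →L[𝕜] V) (α : V [⋀^ι]→L[𝕜] F) (v : ι → V) :
    lieDer A (lieDer B α) v = ∑ i, α (Function.update v i (B (A (v i)))) +
      ∑ i, ∑ j with j ≠ i, α (Function.update (Function.update v i (A (v i))) j (B (v j))) := by
  simp only [lieDer_apply, Finset.sum_neg_distrib, neg_neg]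
  rw [← Finset.sum_add_distrib]
  refine Finset.sum_congr rfl fun i _ => ?_
  rw [← Finset.sum_filter_add_sum_filter_not Finset.univ (fun j => j = i)]
  congr 1
  · simp [Finset.filter_eq']
  · refine Finset.sum_congr rfl fun j hj => ?_
    rw [Function.update_of_ne (by simpa using hj)]

theorem lieDer_commutator (A B : V →L[𝕜] V) (α : V [⋀^ι]→L[𝕜] F) :
    lieDer A (lieDer B α) - lieDer B (lieDer A α) = lieDer (A ∘L B - B ∘L A) α := by
  ext v
  have cross_terms_symm :
      (∑ i, ∑ j with j ≠ i,
        α (Function.update (Function.update v i (A (v i))) j (B (v j)))) =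
      ∑ i, ∑ j with j ≠ i,
        α (Function.update (Function.update v i (B (v i))) j (A (v j))) := by
    simp only [Finset.sum_filter]
    rw [Finset.sum_comm]
    refine Finset.sum_congr rfl fun i _ => Finset.sum_congr rfl fun j _ => ?_
    by_cases h : j = i
    · simp [h]
    · rw [if_pos h, if_pos (Ne.symm h), Function.update_comm h]
  rw [ContinuousAlternatingMap.sub_apply, lieDer_lieDer_apply, lieDer_lieDer_apply,
    cross_terms_symm, lieDer_apply]
  simp only [sub_apply, ContinuousAlternatingMap.map_update_sub, Finset.sum_sub_distrib,
    ContinuousLinearMap.comp_apply]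
  abel

theorem lieDer_comm_of_commute {A B : V →L[𝕜] V} (h : A ∘L B = B ∘L A) (α : V [⋀^ι]→L[𝕜] F) :
    lieDer A (lieDer B α) = lieDer B (lieDer A α) := by
  rw [← sub_eq_zero, lieDer_commutator, h, sub_self, map_zero, zero_apply]

theorem lieDer_compContinuousLinearMap {A : V →L[𝕜] V} {B : W →L[𝕜] W} {g : V →L[𝕜] W}
    (h : g ∘L A = B ∘L g) (α : W [⋀^ι]→L[𝕜] F) :
    lieDer A (α.compContinuousLinearMap g) = (lieDer B α).compContinuousLinearMap g := by
  ext v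
  simp only [lieDer_apply, ContinuousAlternatingMap.compContinuousLinearMap_apply]
  congr 1
  refine Finset.sum_congr rfl fun i _ => congrArg α ?_
  rw [Function.comp_update]
  congr 1
  exact DFunLike.congr_fun h (v i)

theorem lieDer_compContinuousAlternatingMap (A : V →L[𝕜] V) (L : F →L[𝕜] G)
    (α : V [⋀^ι]→L[𝕜] F) :
    lieDer A (L.compContinuousAlternatingMap α) = L.compContinuousAlternatingMap (lieDer A α) := by
  ext v
  simp [lieDer_apply]

theorem lieDer_alternatizeUncurryFin (A : V →L[𝕜] V) (T : V →L[𝕜] V [⋀^Fin k]→L[𝕜] F) :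
    lieDer A (alternatizeUncurryFin T) = alternatizeUncurryFin (lieDer A ∘L T - T ∘L A) := by
  ext v
  simp only [lieDer_apply, alternatizeUncurryFin_apply]
  rw [Finset.sum_comm, ← Finset.sum_neg_distrib]
  refine Finset.sum_congr rfl fun l _ => ?_
  rw [Fin.sum_univ_succAbove _ l]
  simp only [sub_apply, ContinuousLinearMap.comp_apply, ContinuousAlternatingMap.sub_apply,
    lieDer_apply, Function.update_self, Fin.removeNth_update]
  rw [smul_sub, smul_neg, Finset.smul_sum, neg_add, sub_eq_neg_add]
  congr 2
  refine Finset.sum_congr rfl fun j _ => ?_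
  rw [Function.update_of_ne (Fin.ne_succAbove l j)]
  congr 2
  ext m
  rcases eq_or_ne m j with rfl | h
  · simp [Fin.removeNth]
  · simp [Fin.removeNth, h]

theorem fderivCompContinuousLinearMap_comp_left (α : W [⋀^ι]→L[𝕜] F) (A : W →L[𝕜] W)
    (g : V →L[𝕜] W) :
    α.fderivCompContinuousLinearMap g (A ∘L g) = -(lieDer A α).compContinuousLinearMap g := by
  ext v
  simp only [ContinuousAlternatingMap.fderivCompContinuousLinearMap_apply,
    ContinuousAlternatingMap.neg_apply, ContinuousAlternatingMap.compContinuousLinearMap_apply,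
    lieDer_apply, neg_neg]
  refine Finset.sum_congr rfl fun i _ => congrArg α (funext fun j => ?_)
  rcases eq_or_ne j i with rfl | h <;> simp [*]

theorem fderivCompContinuousLinearMap_comp_right (α : W [⋀^ι]→L[𝕜] F) (g : V →L[𝕜] W)
    (A : V →L[𝕜] V) :
    α.fderivCompContinuousLinearMap g (g ∘L A) = -lieDer A (α.compContinuousLinearMap g) := by
  ext v
  simp only [ContinuousAlternatingMap.fderivCompContinuousLinearMap_apply,
    ContinuousAlternatingMap.neg_apply, ContinuousAlternatingMap.compContinuousLinearMap_apply,
    lieDer_apply, neg_neg]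
  refine Finset.sum_congr rfl fun i _ => congrArg α (funext fun j => ?_)
  rcases eq_or_ne j i with rfl | h <;> simp [*]

end Derivation

/-! ### The Casimir operator of `𝔰𝔭(1)` -/

section Quaternions

/-- Left multiplication by quaternions on `ℍⁿ` as an action of the algebra `ℍ`. -/
def leftMulHom (n : ℕ) : ℍ[ℝ] →ₐ[ℝ] ((Fin n → ℍ[ℝ]) →L[ℝ] (Fin n → ℍ[ℝ])) :=
  AlgHom.ofLinearMap
    { toFun := leftMul n
      map_add' := fun a b => by ext v i : 2; exact add_mul a b (v i)
      map_smul' := fun c a => by ext v i : 2; exact smul_mul_assoc c a (v i) }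
    (by ext v i : 2; exact one_mul (v i))
    (fun a b => by ext v i : 2; exact mul_assoc a b (v i))

@[simp]
theorem leftMulHom_apply_apply {n : ℕ} (q : ℍ[ℝ]) (v : Fin n → ℍ[ℝ]) (i : Fin n) :
    leftMulHom n q v i = q * v i := rfl

/-- The quaternion unit `i`. -/
def qI : ℍ[ℝ] := ⟨0, 1, 0, 0⟩

/-- The quaternion unit `j`. -/
def qJ : ℍ[ℝ] := ⟨0, 0, 1, 0⟩

/-- The quaternion unit `k`. -/
def qK : ℍ[ℝ] := ⟨0, 0, 0, 1⟩

@[simp] theorem qI_re : qI.re = 0 := rfl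
@[simp] theorem qI_imI : qI.imI = 1 := rfl
@[simp] theorem qI_imJ : qI.imJ = 0 := rfl
@[simp] theorem qI_imK : qI.imK = 0 := rfl
@[simp] theorem qJ_re : qJ.re = 0 := rfl
@[simp] theorem qJ_imI : qJ.imI = 0 := rfl
@[simp] theorem qJ_imJ : qJ.imJ = 1 := rfl
@[simp] theorem qJ_imK : qJ.imK = 0 := rfl
@[simp] theorem qK_re : qK.re = 0 := rfl
@[simp] theorem qK_imI : qK.imI = 0 := rfl
@[simp] theorem qK_imJ : qK.imJ = 0 := rfl
@[simp] theorem qK_imK : qK.imK = 1 := rfl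

theorem qI_mul_qI : qI * qI = -1 := by ext <;> simp
theorem qJ_mul_qJ : qJ * qJ = -1 := by ext <;> simp
theorem qK_mul_qK : qK * qK = -1 := by ext <;> simp
theorem qI_mul_qJ : qI * qJ = qK := by ext <;> simp
theorem qJ_mul_qK : qJ * qK = qI := by ext <;> simp
theorem qK_mul_qI : qK * qI = qJ := by ext <;> simp
theorem qJ_mul_qI : qJ * qI = -qK := by ext <;> simp
theorem qK_mul_qJ : qK * qJ = -qI := by ext <;> simp
theorem qI_mul_qK : qI * qK = -qJ := by ext <;> simp

theorem eq_add_units_of_re_eq_zero {a : ℍ[ℝ]} (ha : a.re = 0) :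
    a = a.imI • qI + a.imJ • qJ + a.imK • qK := by
  ext <;> simp [ha]

theorem sq_add_sq_eq_one_of_mem_unitary {q : ℍ[ℝ]} (hq : q ∈ unitary ℍ[ℝ]) :
    q.re ^ 2 + q.imI ^ 2 + q.imJ ^ 2 + q.imK ^ 2 = 1 := by
  rw [← Quaternion.normSq_def', ← Quaternion.coe_inj, ← Quaternion.star_mul_self,
    Unitary.star_mul_self_of_mem hq, Quaternion.coe_one]

/-- The Casimir element `-(D i ^ 2 + D j ^ 2 + D k ^ 2)` of a linear map `D` from the quaternions to
an algebra. If `D` comes from the differential of a representation of `Sp(1)`, it acts on the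
irreducible constituents of highest weight `r` as `r (r + 2)`. -/
def casimirElement {A : Type*} [Ring A] [Algebra ℝ A] (D : ℍ[ℝ] →ₗ[ℝ] A) : A :=
  -(D qI * D qI + D qJ * D qJ + D qK * D qK)

theorem casimirElement_comp_conj {A : Type*} [Ring A] [Algebra ℝ A] (D : ℍ[ℝ] →ₗ[ℝ] A) {q : ℍ[ℝ]}
    (hq : q ∈ unitary ℍ[ℝ]) :
    -(D (q * qI * star q) * D (q * qI * star q) + D (q * qJ * star q) * D (q * qJ * star q) +
      D (q * qK * star q) * D (q * qK * star q)) = casimirElement D := by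
  have expand {a : ℍ[ℝ]} (ha : a.re = 0) : D (q * a * star q) =
      (q * a * star q).imI • D qI + (q * a * star q).imJ • D qJ +
        (q * a * star q).imK • D qK := by
    rw [← map_smul, ← map_smul, ← map_smul, ← map_add, ← map_add, ← eq_add_units_of_re_eq_zero]
    simp only [Quaternion.re_mul, Quaternion.imI_mul, Quaternion.imJ_mul, Quaternion.imK_mul,
      Quaternion.re_star, Quaternion.imI_star, Quaternion.imJ_star, Quaternion.imK_star, ha]
    ring
  -- The conjugates of `i`, `j`, `k` are the columns of a rotation matrix of `ℝ³`.
  simp only [casimirElement, expand qI_re, expand qJ_re, expand qK_re, mul_add, add_mul,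
    smul_mul_smul_comm, Quaternion.imI_mul, Quaternion.imJ_mul, Quaternion.imK_mul,
    Quaternion.re_mul, Quaternion.re_star, Quaternion.imI_star, Quaternion.imJ_star,
    Quaternion.imK_star, qI_re, qI_imI, qI_imJ, qI_imK, qJ_re, qJ_imI, qJ_imJ, qJ_imK, qK_re,
    qK_imI, qK_imJ, qK_imK]
  match_scalars
  all_goals first
    | ring1
    | linear_combination -(1 + q.re ^ 2 + q.imI ^ 2 + q.imJ ^ 2 + q.imK ^ 2) *
        sq_add_sq_eq_one_of_mem_unitary hq

end Quaternions

section Casimir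

variable {V : Type*} [NormedAddCommGroup V] [NormedSpace ℝ V]
  {W : Type*} [NormedAddCommGroup W] [NormedSpace ℝ W]
  {F : Type*} [NormedAddCommGroup F] [NormedSpace ℝ F]
  {G : Type*} [NormedAddCommGroup G] [NormedSpace ℝ G]
  {ι : Type*} [Fintype ι] [DecidableEq ι]
  (φ : ℍ[ℝ] →ₐ[ℝ] (V →L[ℝ] V)) (ψ : ℍ[ℝ] →ₐ[ℝ] (W →L[ℝ] W))

/-- The infinitesimal action on forms of the quaternions, acting on the underlying space
through `φ`. -/
def quatDer : ℍ[ℝ] →ₗ[ℝ] (V [⋀^ι]→L[ℝ] F) →L[ℝ] (V [⋀^ι]→L[ℝ] F) :=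
  lieDer ∘ₗ φ.toLinearMap

theorem quatDer_apply (a : ℍ[ℝ]) (α : V [⋀^ι]→L[ℝ] F) : quatDer φ a α = lieDer (φ a) α := rfl

theorem quatDer_commutator (a b : ℍ[ℝ]) (α : V [⋀^ι]→L[ℝ] F) :
    quatDer φ a (quatDer φ b α) - quatDer φ b (quatDer φ a α) = quatDer φ (a * b - b * a) α := by
  rw [quatDer_apply, quatDer_apply, quatDer_apply, quatDer_apply, lieDer_commutator, quatDer_apply,
    map_sub φ, map_mul, map_mul, ContinuousLinearMap.mul_def, ContinuousLinearMap.mul_def]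

theorem quatDer_qI_qJ (α : V [⋀^ι]→L[ℝ] F) :
    quatDer φ qI (quatDer φ qJ α) = quatDer φ qJ (quatDer φ qI α) + (2 : ℝ) • quatDer φ qK α := by
  rw [← sub_eq_iff_eq_add', quatDer_commutator, qI_mul_qJ, qJ_mul_qI, sub_neg_eq_add, map_add,
    add_apply, two_smul]

theorem quatDer_qJ_qK (α : V [⋀^ι]→L[ℝ] F) :
    quatDer φ qJ (quatDer φ qK α) = quatDer φ qK (quatDer φ qJ α) + (2 : ℝ) • quatDer φ qI α := by
  rw [← sub_eq_iff_eq_add', quatDer_commutator, qJ_mul_qK, qK_mul_qJ, sub_neg_eq_add, map_add,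
    add_apply, two_smul]

theorem quatDer_qK_qI (α : V [⋀^ι]→L[ℝ] F) :
    quatDer φ qK (quatDer φ qI α) = quatDer φ qI (quatDer φ qK α) + (2 : ℝ) • quatDer φ qJ α := by
  rw [← sub_eq_iff_eq_add', quatDer_commutator, qK_mul_qI, qI_mul_qK, sub_neg_eq_add, map_add,
    add_apply, two_smul]

theorem quatDer_eq_add_units {a : ℍ[ℝ]} (ha : a.re = 0) (α : V [⋀^ι]→L[ℝ] F) :
    quatDer φ a α =
      a.imI • quatDer φ qI α + a.imJ • quatDer φ qJ α + a.imK • quatDer φ qK α := by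
  conv_lhs => rw [eq_add_units_of_re_eq_zero ha]
  simp only [map_add, map_smul, add_apply, smul_apply]

/-- The Casimir operator of `𝔰𝔭(1)` on forms. -/
def casimir : (V [⋀^ι]→L[ℝ] F) →L[ℝ] (V [⋀^ι]→L[ℝ] F) :=
  casimirElement (quatDer φ)

theorem casimir_apply (α : V [⋀^ι]→L[ℝ] F) : casimir φ α =
    -(quatDer φ qI (quatDer φ qI α) + quatDer φ qJ (quatDer φ qJ α) +
      quatDer φ qK (quatDer φ qK α)) := rfl

theorem casimir_quatDer {a : ℍ[ℝ]} (ha : a.re = 0) (α : V [⋀^ι]→L[ℝ] F) :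
    casimir φ (quatDer φ a α) = quatDer φ a (casimir φ α) := by
  simp only [quatDer_eq_add_units φ ha, casimir_apply, quatDer_qI_qJ, quatDer_qJ_qK,
    quatDer_qK_qI, map_add, map_neg, map_smul]
  module

theorem casimir_lieDer {B : V →L[ℝ] V} (hB : ∀ a, φ a ∘L B = B ∘L φ a) (α : V [⋀^ι]→L[ℝ] F) :
    casimir φ (lieDer B α) = lieDer B (casimir φ α) := by
  have commute (a : ℍ[ℝ]) (α : V [⋀^ι]→L[ℝ] F) :
      quatDer φ a (lieDer B α) = lieDer B (quatDer φ a α) := lieDer_comm_of_commute (hB a) α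
  simp only [casimir_apply, commute, map_add, map_neg]

theorem casimir_compContinuousAlternatingMap (L : F →L[ℝ] G) (α : V [⋀^ι]→L[ℝ] F) :
    casimir φ (L.compContinuousAlternatingMap α) =
      L.compContinuousAlternatingMap (casimir φ α) := by
  simp only [casimir_apply, quatDer_apply, lieDer_compContinuousAlternatingMap]
  ext v
  simp

variable {φ ψ} in
theorem casimir_compContinuousLinearMap {g : V →L[ℝ] W} (hg : ∀ a, g ∘L φ a = ψ a ∘L g)
    (α : W [⋀^ι]→L[ℝ] F) :
    casimir φ (α.compContinuousLinearMap g) = (casimir ψ α).compContinuousLinearMap g := by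
  have natural (a : ℍ[ℝ]) (α : W [⋀^ι]→L[ℝ] F) :
      quatDer φ a (α.compContinuousLinearMap g) = (quatDer ψ a α).compContinuousLinearMap g :=
    lieDer_compContinuousLinearMap (hg a) α
  simp only [casimir_apply, natural]
  rfl

theorem quatDer_compContinuousLinearMap_unitary {q : ℍ[ℝ]} (hq : q ∈ unitary ℍ[ℝ]) (a : ℍ[ℝ])
    (α : V [⋀^ι]→L[ℝ] F) : quatDer φ a (α.compContinuousLinearMap (φ q)) =
      (quatDer φ (q * a * star q) α).compContinuousLinearMap (φ q) := by
  refine lieDer_compContinuousLinearMap (B := φ (q * a * star q)) ?_ α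
  change φ q ∘L φ a = _
  rw [← ContinuousLinearMap.mul_def, ← ContinuousLinearMap.mul_def, ← map_mul, ← map_mul,
    mul_assoc (q * a), Unitary.star_mul_self_of_mem hq, mul_one]

theorem casimir_compContinuousLinearMap_unitary {q : ℍ[ℝ]} (hq : q ∈ unitary ℍ[ℝ])
    (α : V [⋀^ι]→L[ℝ] F) :
    casimir φ (α.compContinuousLinearMap (φ q)) =
      (casimir φ α).compContinuousLinearMap (φ q) := by
  have conj : casimir φ α = _ := (DFunLike.congr_fun
    (casimirElement_comp_conj (A := (V [⋀^ι]→L[ℝ] F) →L[ℝ] (V [⋀^ι]→L[ℝ] F)) (quatDer φ) hq) α).symm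
  rw [conj, casimir_apply]
  simp only [quatDer_compContinuousLinearMap_unitary φ hq]
  rfl

end Casimir

/-! ### A Clebsch–Gordan rule -/

section ClebschGordan

variable {V : Type*} [NormedAddCommGroup V] [NormedSpace ℝ V]
  {W : Type*} [NormedAddCommGroup W] [NormedSpace ℝ W]
  {F : Type*} [NormedAddCommGroup F] [NormedSpace ℝ F]
  {ι : Type*} [Fintype ι] [DecidableEq ι] {k : ℕ}
  (φ : ℍ[ℝ] →ₐ[ℝ] (V →L[ℝ] V)) (ψ : ℍ[ℝ] →ₐ[ℝ] (W →L[ℝ] W))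

/-- The forms on which the Casimir operator acts as on the irreducible representations of highest
weight `r`. For `r ≤ -2` there is no such representation, and this is the space for `-2 - r`. -/
def casimirSpace (r : ℤ) : Submodule ℝ (V [⋀^ι]→L[ℝ] F) :=
  Module.End.eigenspace (casimir φ).toLinearMap (r * (r + 2))

variable {φ} in
theorem mem_casimirSpace_iff {r : ℤ} {α : V [⋀^ι]→L[ℝ] F} :
    α ∈ casimirSpace φ r ↔ casimir φ α = (r * (r + 2) : ℝ) • α :=
  Module.End.mem_eigenspace_iff

theorem disjoint_eigenspace_sup {K N : Type*} [Field K] [AddCommGroup N] [Module K N]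
    (f : Module.End K N) {a b c : K} (hab : a ≠ b) (hac : a ≠ c) :
    Disjoint (f.eigenspace a) (f.eigenspace b ⊔ f.eigenspace c) := by
  refine (f.eigenspaces_iSupIndep a).mono_right (sup_le ?_ ?_)
  · exact le_iSup₂_of_le b hab.symm le_rfl
  · exact le_iSup₂_of_le c hac.symm le_rfl

theorem mul_add_two_ne_of_ne {r s : ℤ} (hrs : r ≠ s) (hrs' : r + s + 2 ≠ 0) :
    (r * (r + 2) : ℝ) ≠ s * (s + 2) := by
  intro h
  have h' : r * (r + 2) = s * (s + 2) := by exact_mod_cast h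
  have factored : (r - s) * (r + s + 2) = 0 := by linear_combination h'
  exact (mul_ne_zero (sub_ne_zero.2 hrs) hrs') factored

theorem disjoint_casimirSpace {r s : ℤ} (hrs : r ≠ s) (hrs' : r + s + 2 ≠ 0) :
    Disjoint (casimirSpace φ r : Submodule ℝ (V [⋀^ι]→L[ℝ] F)) (casimirSpace φ s) :=
  Module.End.disjoint_genEigenspace _ (mul_add_two_ne_of_ne hrs hrs') 1 1

theorem disjoint_casimirSpace_sup {r s t : ℤ} (hrs : r ≠ s) (hrs' : r + s + 2 ≠ 0) (hrt : r ≠ t)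
    (hrt' : r + t + 2 ≠ 0) : Disjoint (casimirSpace φ r : Submodule ℝ (V [⋀^ι]→L[ℝ] F))
      (casimirSpace φ s ⊔ casimirSpace φ t) :=
  disjoint_eigenspace_sup _ (mul_add_two_ne_of_ne hrs hrs') (mul_add_two_ne_of_ne hrt hrt')

variable {φ} in
theorem lieDer_mem_casimirSpace {B : V →L[ℝ] V} (hB : ∀ a, φ a ∘L B = B ∘L φ a) {r : ℤ}
    {α : V [⋀^ι]→L[ℝ] F} (hα : α ∈ casimirSpace φ r) : lieDer B α ∈ casimirSpace φ r := by
  rw [mem_casimirSpace_iff] at hα ⊢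
  rw [casimir_lieDer φ hB, hα, map_smul]

variable {φ} in
theorem quatDer_mem_casimirSpace {a : ℍ[ℝ]} (ha : a.re = 0) {r : ℤ}
    {α : V [⋀^ι]→L[ℝ] F} (hα : α ∈ casimirSpace φ r) : quatDer φ a α ∈ casimirSpace φ r := by
  rw [mem_casimirSpace_iff] at hα ⊢
  rw [casimir_quatDer φ ha, hα, map_smul]

variable {φ ψ} in
theorem compContinuousLinearMap_mem_casimirSpace {g : V →L[ℝ] W}
    (hg : ∀ a, g ∘L φ a = ψ a ∘L g) {r : ℤ} {α : W [⋀^ι]→L[ℝ] F} (hα : α ∈ casimirSpace ψ r) :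
    α.compContinuousLinearMap g ∈ casimirSpace φ r := by
  rw [mem_casimirSpace_iff] at hα ⊢
  rw [casimir_compContinuousLinearMap hg, hα]
  rfl

variable {φ} in
theorem compContinuousLinearMap_unitary_mem_casimirSpace {q : ℍ[ℝ]} (hq : q ∈ unitary ℍ[ℝ])
    {r : ℤ} {α : V [⋀^ι]→L[ℝ] F} (hα : α ∈ casimirSpace φ r) :
    α.compContinuousLinearMap (φ q) ∈ casimirSpace φ r := by
  rw [mem_casimirSpace_iff] at hα ⊢
  rw [casimir_compContinuousLinearMap_unitary φ hq, hα]
  rfl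

/-- The mixed term of the Casimir operator on `V* ⊗ Λᵏ V*`, that is, the sum of the actions of
`u ⊗ u` for `u` among `i`, `j`, `k`, with the sign of the action on `V*` absorbed. -/
def casimirMixed (T : V →L[ℝ] V [⋀^ι]→L[ℝ] F) : V →L[ℝ] V [⋀^ι]→L[ℝ] F :=
  quatDer φ qI ∘L T ∘L φ qI + quatDer φ qJ ∘L T ∘L φ qJ + quatDer φ qK ∘L T ∘L φ qK

theorem casimirMixed_apply (T : V →L[ℝ] V [⋀^ι]→L[ℝ] F) (v : V) :
    casimirMixed φ T v = quatDer φ qI (T (φ qI v)) + quatDer φ qJ (T (φ qJ v)) +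
      quatDer φ qK (T (φ qK v)) := rfl

theorem casimirMixed_casimirMixed_apply (T : V →L[ℝ] V [⋀^ι]→L[ℝ] F) (v : V) :
    casimirMixed φ (casimirMixed φ T) v = casimir φ (T v) - (2 : ℝ) • casimirMixed φ T v := by
  have comp (a b : ℍ[ℝ]) : φ a (φ b v) = φ (a * b) v := by rw [map_mul]; rfl
  simp only [casimirMixed_apply, comp, qI_mul_qI, qJ_mul_qJ, qK_mul_qK, qI_mul_qJ,
    qJ_mul_qK, qK_mul_qI, qJ_mul_qI, qK_mul_qJ, qI_mul_qK, map_neg, map_one, neg_apply,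
    one_apply_eq_self, map_add, casimir_apply, quatDer_qI_qJ, quatDer_qJ_qK,
    quatDer_qK_qI]
  module

theorem quatDer_quatDer_alternatizeUncurryFin {a : ℍ[ℝ]} (ha : a * a = -1)
    (T : V →L[ℝ] V [⋀^Fin k]→L[ℝ] F) :
    quatDer φ a (quatDer φ a (alternatizeUncurryFin T)) = alternatizeUncurryFin
      (quatDer φ a ∘L quatDer φ a ∘L T - (2 : ℝ) • quatDer φ a ∘L T ∘L φ a - T) := by
  rw [quatDer_apply, quatDer_apply, lieDer_alternatizeUncurryFin, lieDer_alternatizeUncurryFin]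
  have square (v : V) : φ a (φ a v) = -v := by
    change (φ a * φ a) v = -v
    rw [← map_mul, ha, map_neg, map_one]
    rfl
  congr 1
  ext1 v
  simp only [sub_apply, smul_apply, ContinuousLinearMap.comp_apply, quatDer_apply, map_sub, square,
    map_neg]
  module

theorem casimir_alternatizeUncurryFin {T : V →L[ℝ] V [⋀^Fin k]→L[ℝ] F} {r : ℤ}
    (hT : ∀ v, T v ∈ casimirSpace φ r) :
    casimir φ (alternatizeUncurryFin T) =
      alternatizeUncurryFin ((r * (r + 2) + 3 : ℝ) • T + (2 : ℝ) • casimirMixed φ T) := by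
  rw [casimir_apply, quatDer_quatDer_alternatizeUncurryFin φ qI_mul_qI,
    quatDer_quatDer_alternatizeUncurryFin φ qJ_mul_qJ,
    quatDer_quatDer_alternatizeUncurryFin φ qK_mul_qK,
    ← alternatizeUncurryFin_add, ← alternatizeUncurryFin_add, ← neg_one_smul ℝ,
    ← alternatizeUncurryFin_smul]
  congr 1
  ext1 v
  have hv := mem_casimirSpace_iff.1 (hT v)
  rw [casimir_apply] at hv
  simp only [add_apply, sub_apply, smul_apply, ContinuousLinearMap.comp_apply, casimirMixed_apply,
    add_smul, ← hv]
  module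

theorem alternatizeUncurryFin_mem_sup {T : V →L[ℝ] V [⋀^Fin k]→L[ℝ] F} {r : ℤ} (hr : r ≠ -1)
    (hT : ∀ v, T v ∈ casimirSpace φ r) :
    alternatizeUncurryFin T ∈ casimirSpace φ (r + 1) ⊔ casimirSpace φ (r - 1) := by
  have hr' : (2 * r + 2 : ℝ) ≠ 0 := by
    have : 2 * r + 2 ≠ 0 := by omega
    exact_mod_cast this
  have mixed_mem (v) : casimirMixed φ T v ∈ casimirSpace φ r :=
    add_mem (add_mem (quatDer_mem_casimirSpace qI_re (hT _))
      (quatDer_mem_casimirSpace qJ_re (hT _))) (quatDer_mem_casimirSpace qK_re (hT _))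
  have mixed_sq : casimirMixed φ (casimirMixed φ T) =
      (r * (r + 2) : ℝ) • T + (-2 : ℝ) • casimirMixed φ T := by
    ext1 v
    rw [casimirMixed_casimirMixed_apply, mem_casimirSpace_iff.1 (hT v), sub_eq_add_neg, ← neg_smul]
    rfl
  have casimir_T := casimir_alternatizeUncurryFin φ hT
  have casimir_mixed := casimir_alternatizeUncurryFin φ mixed_mem
  simp only [mixed_sq, alternatizeUncurryFin_add, alternatizeUncurryFin_smul]
    at casimir_T casimir_mixed
  set ζ := alternatizeUncurryFin T
  set η := alternatizeUncurryFin (casimirMixed φ T)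
  -- `D = casimirMixed φ` satisfies `(D - r) (D + r + 2) T = 0`, so that the components of `T` are
  -- `(2 r + 2)⁻¹ (D + r + 2) T` and `(2 r + 2)⁻¹ (r - D) T`.
  have split : ζ = (2 * r + 2 : ℝ)⁻¹ • (η + (r + 2 : ℝ) • ζ) +
      (2 * r + 2 : ℝ)⁻¹ • ((r : ℝ) • ζ - η) := by
    rw [← smul_add, eq_inv_smul_iff₀ hr']
    module
  rw [split]
  refine Submodule.add_mem_sup (Submodule.smul_mem _ _ (mem_casimirSpace_iff.2 ?_))
    (Submodule.smul_mem _ _ (mem_casimirSpace_iff.2 ?_))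
  · simp only [map_add, map_smul, casimir_T, casimir_mixed, Int.cast_add, Int.cast_one]
    module
  · simp only [map_sub, map_smul, casimir_T, casimir_mixed, Int.cast_sub, Int.cast_one]
    module

end ClebschGordan

/-! ### Representations of `Sp(1)` -/

section Weights

@[simp] theorem expIQuat_re (θ : ℝ) : (expIQuat θ).re = Real.cos θ := rfl
@[simp] theorem expIQuat_imI (θ : ℝ) : (expIQuat θ).imI = Real.sin θ := rfl
@[simp] theorem expIQuat_imJ (θ : ℝ) : (expIQuat θ).imJ = 0 := rfl
@[simp] theorem expIQuat_imK (θ : ℝ) : (expIQuat θ).imK = 0 := rfl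

theorem expI_zero : expI 0 = 1 := by
  ext <;> simp [expI]

theorem expI_two_pi : expI (2 * Real.pi) = 1 := by
  ext <;> simp [expI]

/-- The quaternion `j` as an element of `Sp(1)`. -/
def unitJ : Sp1 :=
  ⟨qJ, Unitary.mem_iff.2 ⟨by ext <;> simp, by ext <;> simp⟩⟩

theorem expI_mul_unitJ (θ : ℝ) : expI θ * unitJ = unitJ * expI (-θ) := by
  ext <;> simp [expI, unitJ]

variable {X : Type*} [AddCommGroup X] [Module ℂ X] {ρ : Representation ℂ Sp1 X} {r m : ℤ}

theorem HasWeight.neg (h : HasWeight ρ m) : HasWeight ρ (-m) := by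
  obtain ⟨w, hw0, hw⟩ := h
  refine ⟨ρ unitJ w, fun h0 => hw0 ?_, fun θ => ?_⟩
  · rw [← ρ.inv_self_apply unitJ w, h0, map_zero]
  · rw [← Module.End.mul_apply, ← map_mul, expI_mul_unitJ, map_mul, Module.End.mul_apply, hw,
      map_smul]
    congr 2
    push_cast
    ring

theorem HasHighestWeight.nonneg (h : HasHighestWeight ρ r) : 0 ≤ r := by
  have := h.2 _ h.1.neg
  omega

/-- The order isomorphism between the subrepresentations of a subrepresentation `W` and the
subrepresentations contained in `W`. -/
def subrepresentationIic (W : Subrepresentation ρ) :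
    Subrepresentation W.toRepresentation ≃o Set.Iic W where
  toFun P := ⟨⟨P.toSubmodule.map W.toSubmodule.subtype, by
    rintro q _ ⟨x, hx, rfl⟩
    exact ⟨_, P.apply_mem_toSubmodule q hx, rfl⟩⟩, Submodule.map_subtype_le _ _⟩
  invFun P := ⟨P.1.toSubmodule.comap W.toSubmodule.subtype,
    fun q _ hx => P.1.apply_mem_toSubmodule q hx⟩
  left_inv P := Subrepresentation.toSubmodule_injective
    (Submodule.comap_map_eq_of_injective W.toSubmodule.injective_subtype _)
  right_inv P := Subtype.ext <| Subrepresentation.toSubmodule_injective <|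
    (Submodule.map_comap_subtype _ _).trans (inf_eq_right.2 P.2)
  map_rel_iff' := Submodule.map_le_map_iff_of_injective W.toSubmodule.injective_subtype _ _

theorem isIrreducible_iff_isAtom {W : Subrepresentation ρ} :
    Representation.IsIrreducible (k := ℂ) (V := W.toSubmodule) W.toRepresentation ↔ IsAtom W :=
  (subrepresentationIic W).isSimpleOrder_iff.trans Set.isSimpleOrder_Iic_iff_isAtom

/-- The sum of the irreducible subrepresentations of highest weight `r`. -/
def isotypic (ρ : Representation ℂ Sp1 X) (r : ℤ) : Submodule ℂ X :=
  ⨆ (W : Subrepresentation ρ)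
    (_ : Representation.IsIrreducible (k := ℂ) (V := W.toSubmodule) W.toRepresentation)
    (_ : HasHighestWeight W.toRepresentation r), W.toSubmodule

theorem isotypic_le_iff {N : Submodule ℂ X} : isotypic ρ r ≤ N ↔ ∀ W : Subrepresentation ρ,
    IsAtom W → HasHighestWeight W.toRepresentation r → W.toSubmodule ≤ N := by
  simp only [isotypic, iSup_le_iff, isIrreducible_iff_isAtom]

theorem le_isotypic {W : Subrepresentation ρ} (hW : IsAtom W)
    (hr : HasHighestWeight W.toRepresentation r) : W.toSubmodule ≤ isotypic ρ r :=
  isotypic_le_iff.1 le_rfl W hW hr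

theorem isotypic_eq_bot (hr : r < 0) : isotypic ρ r = ⊥ :=
  eq_bot_iff.2 <| isotypic_le_iff.2 fun _ _ h => absurd h.nonneg hr.not_ge

theorem isotypic_le_comap (ρ : Representation ℂ Sp1 X) (r : ℤ) (q : Sp1) :
    isotypic ρ r ≤ (isotypic ρ r).comap (ρ q) :=
  isotypic_le_iff.2 fun W hW hr _ hw => le_isotypic hW hr (W.apply_mem_toSubmodule q hw)

end Weights

section Differential

variable {X : Type*} [NormedAddCommGroup X] [NormedSpace ℝ X] [NormedSpace ℂ X]
  [IsScalarTower ℝ ℂ X] {ρ : Representation ℂ Sp1 X} {D : ℍ[ℝ] →ₗ[ℝ] Module.End ℂ X}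

/-- On the imaginary quaternions, that is, on `𝔰𝔭(1)`, the map `D` is the differential of the
representation `ρ`. By equivariance it suffices to require this in the direction `i`. -/
structure IsDifferential (ρ : Representation ℂ Sp1 X) (D : ℍ[ℝ] →ₗ[ℝ] Module.End ℂ X) :
    Prop where
  hasDerivAt_expI (x : X) (θ : ℝ) :
    HasDerivAt (fun t : ℝ => ρ (expI t) x) (ρ (expI θ) (D qI x)) θ
  conj (q : Sp1) (a : ℍ[ℝ]) (x : X) : D (q * a * star (q : ℍ[ℝ])) (ρ q x) = ρ q (D a x)
  commutator (a b : ℍ[ℝ]) (x : X) : D a (D b x) - D b (D a x) = D (a * b - b * a) x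

namespace IsDifferential

variable (hD : IsDifferential ρ D)
include hD

theorem hasDerivAt_expI_zero (x : X) : HasDerivAt (fun t : ℝ => ρ (expI t) x) (D qI x) 0 := by
  have h := hD.hasDerivAt_expI x 0
  rwa [expI_zero, map_one] at h

theorem apply_eq_smul_iff {w : X} {c : ℂ} :
    D qI w = c • w ↔ ∀ θ : ℝ, ρ (expI θ) w = Complex.exp (c * θ) • w := by
  have exp_deriv (c : ℂ) (t : ℝ) :
      HasDerivAt (fun s : ℝ => Complex.exp (c * s)) (Complex.exp (c * t) * c) t := by
    simpa using ((hasDerivAt_id (t : ℂ)).const_mul c).cexp.comp_ofReal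
  constructor
  · intro hw θ
    have deriv_zero (t : ℝ) :
        HasDerivAt (fun t : ℝ => Complex.exp (-c * t) • ρ (expI t) w) 0 t := by
      have h := (exp_deriv (-c) t).smul (hD.hasDerivAt_expI w t)
      rw [hw, map_smul] at h
      have cancel : (0 : X) = Complex.exp (-c * t) • c • ρ (expI t) w +
          (Complex.exp (-c * t) * -c) • ρ (expI t) w := by module
      rwa [← cancel] at h
    have const := is_const_of_deriv_eq_zero (fun t => (deriv_zero t).differentiableAt)
      (fun t => (deriv_zero t).deriv) θ 0
    simp only [Complex.ofReal_zero, mul_zero, Complex.exp_zero, expI_zero, map_one, one_smul,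
      Module.End.one_apply] at const
    conv_rhs => rw [← const]
    rw [smul_smul, ← Complex.exp_add, neg_mul, add_neg_cancel, Complex.exp_zero, one_smul]
  · intro hw
    have h := hD.hasDerivAt_expI_zero w
    simp only [hw] at h
    simpa using h.unique ((exp_deriv c 0).smul_const w)

theorem hasWeight_iff {W : Subrepresentation ρ} {m : ℤ} : HasWeight W.toRepresentation m ↔
    ∃ w ∈ W, w ≠ 0 ∧ D qI w = (Complex.I * m) • w := by
  simp only [hD.apply_eq_smul_iff]
  constructor
  · rintro ⟨w, hw0, hw⟩
    exact ⟨w, w.2, by simpa using hw0, fun θ => congrArg Subtype.val (hw θ)⟩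
  · rintro ⟨w, hw, hw0, h⟩
    exact ⟨⟨w, hw⟩, by simpa using hw0, fun θ => Subtype.ext (h θ)⟩

theorem exists_int_of_apply_eq_smul {w : X} (hw0 : w ≠ 0) {c : ℂ} (hw : D qI w = c • w) :
    ∃ m : ℤ, c = Complex.I * m := by
  have h := hD.apply_eq_smul_iff.1 hw (2 * Real.pi)
  rw [expI_two_pi, map_one, Module.End.one_apply] at h
  have exp_eq_one : Complex.exp (c * (2 * Real.pi : ℝ)) = 1 :=
    smul_left_injective ℂ hw0 (h.symm.trans (one_smul ℂ w).symm)
  obtain ⟨m, hm⟩ := Complex.exp_eq_one_iff.1 exp_eq_one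
  refine ⟨m, mul_right_cancel₀ (Complex.ofReal_ne_zero.2 Real.two_pi_pos.ne') ?_⟩
  rw [hm]
  push_cast
  ring

theorem casimirElement_comm (q : Sp1) (x : X) :
    casimirElement D (ρ q x) = ρ q (casimirElement D x) := by
  conv_lhs => rw [← casimirElement_comp_conj D q.2]
  simp only [casimirElement, LinearMap.neg_apply, LinearMap.add_apply, Module.End.mul_apply,
    hD.conj, map_add, map_neg]

omit hD in
theorem mem_of_hasDerivAt [FiniteDimensional ℂ X] (W : Submodule ℂ X) {f : ℝ → X} {f' : X} {t : ℝ}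
    (hf : HasDerivAt f f' t) (hW : ∀ s, f s ∈ W) : f' ∈ W := by
  refine W.closed_of_finiteDimensional.mem_of_tendsto (hasDerivAt_iff_tendsto_slope.1 hf)
    (Filter.Eventually.of_forall fun s => ?_)
  rw [slope_def_module]
  exact (W.restrictScalars ℝ).smul_mem _ (W.sub_mem (hW _) (hW _))

variable [FiniteDimensional ℂ X] {W : Subrepresentation ρ} {w : X}

theorem apply_conj_qI_mem (hw : w ∈ W) (q : Sp1) : D (q * qI * star (q : ℍ[ℝ])) w ∈ W := by
  have mem {x : X} (hx : x ∈ W) : D qI x ∈ W :=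
    mem_of_hasDerivAt W.toSubmodule (hD.hasDerivAt_expI_zero x)
      fun _ => W.apply_mem_toSubmodule _ hx
  rw [← ρ.self_inv_apply q w, hD.conj]
  exact W.apply_mem_toSubmodule q (mem (W.apply_mem_toSubmodule q⁻¹ hw))

theorem apply_mem (hw : w ∈ W) {a : ℍ[ℝ]} (ha : a.re = 0) : D a w ∈ W := by
  -- Conjugation by `u = (1 + i + j + k) / 2` permutes `i`, `j` and `k` cyclically.
  let u : Sp1 := ⟨(1 / 2 : ℝ) • (1 + qI + qJ + qK), Unitary.mem_iff.2
    ⟨by ext <;> norm_num, by ext <;> norm_num⟩⟩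
  have conj_one : ((1 : Sp1) : ℍ[ℝ]) * qI * star ((1 : Sp1) : ℍ[ℝ]) = qI := by simp
  have conj_u : (u : ℍ[ℝ]) * qI * star (u : ℍ[ℝ]) = qJ := by
    ext <;> norm_num [u]
  have conj_star_u : ((star u : Sp1) : ℍ[ℝ]) * qI * star ((star u : Sp1) : ℍ[ℝ]) = qK := by
    ext <;> norm_num [u]
  have mem (q : Sp1) (c : ℝ) : c • D (q * qI * star (q : ℍ[ℝ])) w ∈ W.toSubmodule :=
    (W.toSubmodule.restrictScalars ℝ).smul_mem c (hD.apply_conj_qI_mem hw q)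
  rw [eq_add_units_of_re_eq_zero ha, ← conj_one, ← conj_u, ← conj_star_u]
  simp only [map_add, map_smul]
  exact W.toSubmodule.add_mem (W.toSubmodule.add_mem (mem 1 _) (mem u _)) (mem (star u) _)

theorem exists_hasHighestWeight (hW : W ≠ ⊥) : ∃ r, HasHighestWeight W.toRepresentation r := by
  have nonempty : {m : ℤ | HasWeight W.toRepresentation m}.Nonempty := by
    have : Nontrivial W.toSubmodule := Submodule.nontrivial_iff_ne_bot.2
      fun h => hW (Subrepresentation.toSubmodule_injective h)
    obtain ⟨c, hc⟩ := Module.End.exists_eigenvalue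
      ((D qI).restrict fun w hw => hD.apply_mem (W := W) hw qI_re :
        W.toSubmodule →ₗ[ℂ] W.toSubmodule)
    obtain ⟨w, hw⟩ := hc.exists_hasEigenvector
    have eigen : D qI w = c • (w : X) := congrArg Subtype.val hw.apply_eq_smul
    have hw0 : (w : X) ≠ 0 := by simpa using hw.2
    obtain ⟨m, rfl⟩ := hD.exists_int_of_apply_eq_smul hw0 eigen
    exact ⟨m, hD.hasWeight_iff.2 ⟨w, w.2, hw0, eigen⟩⟩
  have finite : {m : ℤ | HasWeight W.toRepresentation m}.Finite := by
    refine Set.Finite.of_finite_image (f := fun m : ℤ => Complex.I * m)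
      ((Module.End.finite_hasEigenvalue (D qI)).subset ?_) fun a _ b _ hab => ?_
    · rintro _ ⟨m, hm, rfl⟩
      obtain ⟨w, -, hw0, hw⟩ := hD.hasWeight_iff.1 hm
      exact Module.End.hasEigenvalue_of_hasEigenvector ⟨Module.End.mem_eigenspace_iff.2 hw, hw0⟩
    · simpa using hab
  obtain ⟨r, hr, hmax⟩ := finite.exists_maximalFor id _ nonempty
  exact ⟨r, hr, fun m hm => (le_total m r).elim id fun h => hmax hm h⟩

theorem exists_casimirElement_eq {r : ℤ} (hr : HasHighestWeight W.toRepresentation r) :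
    ∃ w ∈ W, w ≠ 0 ∧ casimirElement D w = (r * (r + 2) : ℂ) • w := by
  obtain ⟨w, hw, hw0, hI⟩ := hD.hasWeight_iff.1 hr.1
  refine ⟨w, hw, hw0, ?_⟩
  have comm_IJ : D qI (D qJ w) = D qJ (D qI w) + (2 : ℂ) • D qK w := by
    rw [← sub_eq_iff_eq_add', hD.commutator, qI_mul_qJ, qJ_mul_qI, sub_neg_eq_add, map_add,
      LinearMap.add_apply, two_smul]
  have comm_JK : D qJ (D qK w) = D qK (D qJ w) + (2 : ℂ) • D qI w := by
    rw [← sub_eq_iff_eq_add', hD.commutator, qJ_mul_qK, qK_mul_qJ, sub_neg_eq_add, map_add,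
      LinearMap.add_apply, two_smul]
  have comm_KI : D qK (D qI w) = D qI (D qK w) + (2 : ℂ) • D qJ w := by
    rw [← sub_eq_iff_eq_add', hD.commutator, qK_mul_qI, qI_mul_qK, sub_neg_eq_add, map_add,
      LinearMap.add_apply, two_smul]
  -- `J - i K` raises the weight by `2`.
  have raise_eq_zero : D qJ w - Complex.I • D qK w = 0 := by
    by_contra hne
    have weight_add_two : HasWeight W.toRepresentation (r + 2) := by
      refine hD.hasWeight_iff.2 ⟨_, W.toSubmodule.sub_mem (hD.apply_mem hw qJ_re)
        (W.toSubmodule.smul_mem _ (hD.apply_mem hw qK_re)), hne, ?_⟩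
      rw [map_sub, map_smul, comm_IJ, ← sub_eq_of_eq_add comm_KI, hI, map_smul, map_smul]
      push_cast
      match_scalars
      · ring
      · linear_combination (2 : ℂ) * Complex.I_mul_I
    have := hr.2 _ weight_add_two
    omega
  have hJ : D qJ w = Complex.I • D qK w := sub_eq_zero.1 raise_eq_zero
  have hK : D qK w = -Complex.I • D qJ w := by
    rw [hJ, smul_smul, neg_mul, Complex.I_mul_I, neg_neg, one_smul]
  have hJJ : D qJ (D qJ w) = Complex.I • D qJ (D qK w) := by rw [← map_smul, ← hJ]
  have hKK : D qK (D qK w) = -Complex.I • D qK (D qJ w) := by rw [← map_smul, ← hK]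
  simp only [casimirElement, LinearMap.neg_apply, LinearMap.add_apply, Module.End.mul_apply]
  rw [hJJ, hKK, comm_JK, hI, map_smul, hI]
  match_scalars
  · linear_combination (-(r : ℂ) ^ 2 - 2 * r) * Complex.I_mul_I
  · ring

omit [FiniteDimensional ℂ X] in
/-- The eigenspace of the Casimir element for the eigenvalue `c`, as a subrepresentation. -/
def casimirEigenspace (c : ℂ) : Subrepresentation ρ where
  toSubmodule := Module.End.eigenspace (casimirElement D) c
  apply_mem_toSubmodule q w hw := by
    rw [Module.End.mem_eigenspace_iff] at hw ⊢
    rw [hD.casimirElement_comm, hw, map_smul]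

theorem isotypic_le_eigenspace (r : ℤ) :
    isotypic ρ r ≤ Module.End.eigenspace (casimirElement D) (r * (r + 2) : ℂ) := by
  refine isotypic_le_iff.2 fun W hW hr => ?_
  obtain ⟨w, hw, hw0, eigen⟩ := hD.exists_casimirElement_eq hr
  refine (hW.not_disjoint_iff_le (b := hD.casimirEigenspace (r * (r + 2)))).1 fun h => hw0 ?_
  exact (Submodule.mem_bot ℂ).1
    (h.le_bot (⟨hw, Module.End.mem_eigenspace_iff.2 eigen⟩ : w ∈ W ⊓ hD.casimirEigenspace _))

theorem isotypic_eq_eigenspace [ρ.IsSemisimpleRepresentation] {r : ℤ} (hr : -1 ≤ r) :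
    isotypic ρ r = Module.End.eigenspace (casimirElement D) (r * (r + 2) : ℂ) := by
  have : WellFoundedLT (Subrepresentation ρ) :=
    StrictMono.wellFoundedLT (f := Subrepresentation.toSubmodule) fun _ _ h => h
  let S : Subrepresentation ρ := ⟨isotypic ρ r, isotypic_le_comap ρ r⟩
  let N := hD.casimirEigenspace (r * (r + 2))
  obtain ⟨U, hU⟩ := exists_isCompl S
  have inf_eq_bot : U ⊓ N = ⊥ := by
    by_contra hne
    obtain ⟨W, hW, hWle⟩ := (IsAtomic.eq_bot_or_exists_atom_le (U ⊓ N)).resolve_left hne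
    obtain ⟨s, hs⟩ := hD.exists_hasHighestWeight hW.1
    obtain ⟨w, hw, hw0, eigen⟩ := hD.exists_casimirElement_eq hs
    have eigen' := Module.End.mem_eigenspace_iff.1 (hWle hw).2
    have : (s : ℂ) * (s + 2) = r * (r + 2) :=
      smul_left_injective ℂ hw0 (eigen.symm.trans eigen')
    have s_eq : s = r := by
      by_contra s_ne
      exact mul_add_two_ne_of_ne s_ne (by have := hs.nonneg; omega) (by exact_mod_cast this)
    exact hW.1 (le_bot_iff.1 (hU.disjoint (le_isotypic hW (s_eq ▸ hs)) fun x hx => (hWle hx).1))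
  have S_le : S.toSubmodule ≤ N.toSubmodule := hD.isotypic_le_eigenspace r
  have sup_eq_top : S.toSubmodule ⊔ U.toSubmodule = ⊤ :=
    congrArg Subrepresentation.toSubmodule hU.codisjoint.eq_top
  have inf_eq_bot' : U.toSubmodule ⊓ N.toSubmodule = ⊥ :=
    congrArg Subrepresentation.toSubmodule inf_eq_bot
  have modular := sup_inf_assoc_of_le U.toSubmodule S_le
  rwa [sup_eq_top, top_inf_eq, inf_eq_bot', sup_bot_eq, eq_comm] at modular

end IsDifferential

end Differential

/-! ### The representation of `Sp(1)` on forms -/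

section Semisimple

theorem isSemisimpleRepresentation_of_inner_invariant {𝕜 G X H : Type*} [RCLike 𝕜] [Group G]
    [AddCommGroup X] [Module 𝕜 X] [NormedAddCommGroup H] [InnerProductSpace 𝕜 H]
    [FiniteDimensional 𝕜 H] {ρ : Representation 𝕜 G X} {Φ : X →ₗ[𝕜] H}
    (hΦ : Function.Injective Φ)
    (hρ : ∀ g x y, inner 𝕜 (Φ (ρ g x)) (Φ (ρ g y)) = inner 𝕜 (Φ x) (Φ y)) :
    ρ.IsSemisimpleRepresentation := by
  refine ⟨fun U => ⟨⟨(U.toSubmodule.map Φ)ᗮ.comap Φ, fun g x hx => ?_⟩, ?_, ?_⟩⟩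
  · rw [Submodule.mem_comap, Submodule.mem_orthogonal]
    rintro _ ⟨y, hy, rfl⟩
    rw [← ρ.self_inv_apply g y, hρ]
    exact (Submodule.mem_orthogonal _ _).1 hx _ ⟨_, U.apply_mem_toSubmodule g⁻¹ hy, rfl⟩
  · rw [disjoint_iff_inf_le]
    intro x hx
    have h := (Submodule.mem_orthogonal _ _).1 hx.2 _ ⟨x, hx.1, rfl⟩
    exact (Submodule.mem_bot 𝕜).2 (hΦ ((inner_self_eq_zero.1 h).trans (map_zero Φ).symm))
  · rw [codisjoint_iff_le_sup]
    intro x _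
    obtain ⟨_, ⟨y, hy, rfl⟩, z, hz, h⟩ :=
      (U.toSubmodule.map Φ).exists_add_mem_mem_orthogonal (Φ x)
    refine Submodule.mem_sup.2 ⟨y, hy, x - y, ?_, by abel⟩
    rw [Submodule.mem_comap, map_sub, h, add_sub_cancel_left]
    exact hz

theorem prod_mem_unitaryGroup {ι κ R : Type*} [Fintype ι] [DecidableEq ι] [Fintype κ]
    [DecidableEq κ] [CommRing R] [StarRing R] {M : Matrix ι ι R}
    (hM : M ∈ Matrix.unitaryGroup ι R) :
    Matrix.of (fun f h : κ → ι => ∏ l, M (f l) (h l)) ∈ Matrix.unitaryGroup (κ → ι) R := by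
  rw [Matrix.mem_unitaryGroup_iff] at hM ⊢
  ext f f'
  have entry (i i' : ι) : ∑ j, M i j * star (M i' j) = (1 : Matrix ι ι R) i i' := by
    rw [← hM]
    rfl
  calc ∑ h : κ → ι, (∏ l, M (f l) (h l)) * star (∏ l, M (f' l) (h l))
      = ∏ l, (1 : Matrix ι ι R) (f l) (f' l) := by
        simp only [star_prod, ← Finset.prod_mul_distrib, ← entry, Finset.prod_univ_sum,
          Fintype.piFinset_univ]
    _ = (1 : Matrix (κ → ι) (κ → ι) R) f f' := by
        simp only [Matrix.one_apply, Finset.prod_ite_zero, Finset.mem_univ, forall_const,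
          Finset.prod_const_one, funext_iff]

end Semisimple

section BasisValues

open scoped Matrix

variable {V : Type*} [NormedAddCommGroup V] [NormedSpace ℝ V] {ι : Type*} {k : ℕ}

/-- The values of a form on the tuples of basis vectors. -/
def basisValues (b : Module.Basis ι ℝ V) (k : ℕ) :
    (V [⋀^Fin k]→L[ℝ] ℂ) →ₗ[ℂ] EuclideanSpace ℂ (Fin k → ι) where
  toFun α := WithLp.toLp 2 fun f => α (b ∘ f)
  map_add' _ _ := rfl
  map_smul' _ _ := rfl

theorem basisValues_injective (b : Module.Basis ι ℝ V) (k : ℕ) :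
    Function.Injective (basisValues b k) := fun _ _ h =>
  ContinuousAlternatingMap.toAlternatingMap_injective <|
    Module.Basis.ext_alternating b fun f _ => congrFun (congrArg WithLp.ofLp h) f

variable [Fintype ι] [DecidableEq ι] (b : Module.Basis ι ℝ V)

theorem basisValues_compContinuousLinearMap (g : V →L[ℝ] V) (α : V [⋀^Fin k]→L[ℝ] ℂ) :
    (basisValues b k (α.compContinuousLinearMap g)).ofLp =
      Matrix.of (fun f h : Fin k → ι => ∏ l, (LinearMap.toMatrix b b g.toLinearMap)ᵀ.map
        Complex.ofRealHom (f l) (h l)) *ᵥ (basisValues b k α).ofLp := by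
  funext f
  have expand : (g ∘ (b ∘ f)) =
      fun l => ∑ j, LinearMap.toMatrix b b g.toLinearMap j (f l) • b j := by
    funext l
    simp only [LinearMap.toMatrix_apply]
    exact (b.sum_repr _).symm
  change α (g ∘ (b ∘ f)) = _
  rw [expand, ContinuousAlternatingMap.map_sum]
  refine Finset.sum_congr rfl fun h _ => ?_
  rw [ContinuousAlternatingMap.map_smul_univ, Complex.real_smul, Complex.ofReal_prod]
  rfl

theorem inner_basisValues_compContinuousLinearMap {g : V →L[ℝ] V}
    (hg : LinearMap.toMatrix b b g.toLinearMap ∈ Matrix.orthogonalGroup ι ℝ)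
    (α β : V [⋀^Fin k]→L[ℝ] ℂ) :
    inner ℂ (basisValues b k (α.compContinuousLinearMap g))
      (basisValues b k (β.compContinuousLinearMap g)) =
    inner ℂ (basisValues b k α) (basisValues b k β) := by
  have unitary_transpose : (LinearMap.toMatrix b b g.toLinearMap)ᵀ.map Complex.ofRealHom ∈
      Matrix.unitaryGroup ι ℂ := by
    have star_eq : star ((LinearMap.toMatrix b b g.toLinearMap)ᵀ.map Complex.ofRealHom) =
        (LinearMap.toMatrix b b g.toLinearMap).map Complex.ofRealHom := by
      ext i j
      exact Complex.conj_ofReal _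
    rw [Matrix.mem_unitaryGroup_iff, star_eq, ← Matrix.map_mul,
      (Matrix.mem_orthogonalGroup_iff' ι ℝ).1 hg, Matrix.map_one _ (map_zero _) (map_one _)]
  have h := Matrix.mem_unitaryGroup_iff'.1 (prod_mem_unitaryGroup (κ := Fin k) unitary_transpose)
  simp only [EuclideanSpace.inner_eq_star_dotProduct, basisValues_compContinuousLinearMap]
  rw [Matrix.star_mulVec, dotProduct_comm, ← Matrix.dotProduct_mulVec, Matrix.mulVec_mulVec,
    ← Matrix.star_eq_conjTranspose, h, Matrix.one_mulVec, dotProduct_comm]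

end BasisValues

section FormRep

open scoped Matrix

variable {V : Type*} [NormedAddCommGroup V] [NormedSpace ℝ V] {n k : ℕ}
  (p : V ≃L[ℝ] (Fin n → ℍ[ℝ]))

/-- The basis `1, i, j, k` of `ℍ`. -/
def unitsBasis : Module.Basis (Fin 4) ℝ ℍ[ℝ] := QuaternionAlgebra.basisOneIJK (-1 : ℝ) 0 (-1)

/-- The standard real basis of `ℍⁿ`. -/
def quatBasis (n : ℕ) : Module.Basis ((_ : Fin n) × Fin 4) ℝ (Fin n → ℍ[ℝ]) :=
  Pi.basis fun _ => unitsBasis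

theorem quatBasis_repr_apply (v : Fin n → ℍ[ℝ]) (j : (_ : Fin n) × Fin 4) :
    (quatBasis n).repr v j =
      ![(v j.1).re, (v j.1).imI, (v j.1).imJ, (v j.1).imK] j.2 := by
  rw [quatBasis, Pi.basis_repr]
  rfl

theorem quatBasis_apply (i : (_ : Fin n) × Fin 4) :
    quatBasis n i = Pi.single i.1 (![1, qI, qJ, qK] i.2) := by
  obtain ⟨m, a⟩ := i
  refine (quatBasis n).repr.injective (Finsupp.ext fun ⟨l, c⟩ => ?_)
  rw [Module.Basis.repr_self, quatBasis_repr_apply]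
  rcases eq_or_ne m l with rfl | h
  · rw [Pi.single_eq_same]
    fin_cases a <;> fin_cases c <;> simp
  · rw [Pi.single_eq_of_ne h.symm, Finsupp.single_eq_of_ne (by simp [h.symm])]
    fin_cases c <;> rfl

theorem toMatrix_leftMulHom_star (q : ℍ[ℝ]) :
    LinearMap.toMatrix (quatBasis n) (quatBasis n) (leftMulHom n (star q)).toLinearMap =
      (LinearMap.toMatrix (quatBasis n) (quatBasis n) (leftMulHom n q).toLinearMap)ᵀ := by
  ext ⟨m, a⟩ ⟨l, c⟩
  rw [Matrix.transpose_apply, LinearMap.toMatrix_apply, LinearMap.toMatrix_apply,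
    quatBasis_repr_apply, quatBasis_repr_apply, quatBasis_apply, quatBasis_apply]
  simp only [ContinuousLinearMap.coe_coe, leftMulHom_apply_apply]
  rcases eq_or_ne m l with rfl | h
  · simp only [Pi.single_eq_same]
    fin_cases a <;> fin_cases c <;> simp
  · simp only [Pi.single_eq_of_ne h, Pi.single_eq_of_ne h.symm, mul_zero]
    fin_cases a <;> fin_cases c <;> simp

theorem toMatrix_leftMulHom_mem_orthogonalGroup {q : ℍ[ℝ]} (hq : q ∈ unitary ℍ[ℝ]) :
    LinearMap.toMatrix (quatBasis n) (quatBasis n) (leftMulHom n q).toLinearMap ∈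
      Matrix.orthogonalGroup _ ℝ := by
  refine (Matrix.mem_orthogonalGroup_iff _ _).2 ?_
  rw [← toMatrix_leftMulHom_star, ← LinearMap.toMatrix_mul, ← LinearMap.toMatrix_one (quatBasis n)]
  congr 1
  change ((leftMulHom n q * leftMulHom n (star q)) : _ →L[ℝ] _).toLinearMap = _
  rw [← map_mul, Unitary.mul_star_self_of_mem hq, map_one]
  rfl

/-- The action of the algebra `ℍ` on `V` obtained from an isomorphism `p : V ≅ ℍⁿ`. -/
def quatActHom : ℍ[ℝ] →ₐ[ℝ] (V →L[ℝ] V) :=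
  (p.symm.conjContinuousAlgEquiv : _ →ₐ[ℝ] _).comp (leftMulHom n)

/-- The real basis of `V` that `p` sends to the standard basis of `ℍⁿ`. -/
def frameBasis : Module.Basis ((_ : Fin n) × Fin 4) ℝ V :=
  (quatBasis n).map p.symm.toLinearEquiv

theorem toMatrix_quatActHom (q : ℍ[ℝ]) :
    LinearMap.toMatrix (frameBasis p) (frameBasis p) (quatActHom p q).toLinearMap =
      LinearMap.toMatrix (quatBasis n) (quatBasis n) (leftMulHom n q).toLinearMap := by
  ext i j
  simp [LinearMap.toMatrix_apply, frameBasis, quatActHom]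

include p in
theorem finiteDimensional_forms (k : ℕ) : FiniteDimensional ℂ (V [⋀^Fin k]→L[ℝ] ℂ) :=
  FiniteDimensional.of_injective _ (basisValues_injective (frameBasis p) k)

theorem formRep_apply (q : Sp1) (α : V [⋀^Fin k]→L[ℝ] ℂ) :
    formRep p k q α = α.compContinuousLinearMap (quatActHom p (star (q : ℍ[ℝ]))) := rfl

theorem isSemisimpleRepresentation_formRep : (formRep p k).IsSemisimpleRepresentation := by
  refine isSemisimpleRepresentation_of_inner_invariant (basisValues_injective (frameBasis p) k)
    fun q α β => inner_basisValues_compContinuousLinearMap _ ?_ α β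
  exact (toMatrix_quatActHom p _).symm ▸
    toMatrix_leftMulHom_mem_orthogonalGroup (Unitary.star_mem q.2)

/-- The infinitesimal action of the quaternions on complex-valued forms, by complex-linear maps. -/
def complexQuatDer (φ : ℍ[ℝ] →ₐ[ℝ] (V →L[ℝ] V)) (k : ℕ) :
    ℍ[ℝ] →ₗ[ℝ] Module.End ℂ (V [⋀^Fin k]→L[ℝ] ℂ) where
  toFun a :=
    { toFun := quatDer φ a
      map_add' := map_add _
      map_smul' := fun c α => by
        ext v
        simp [quatDer_apply, lieDer_apply, Finset.mul_sum] }
  map_add' a b := by ext α : 1; simp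
  map_smul' c a := by ext α : 1; simp

theorem complexQuatDer_apply (φ : ℍ[ℝ] →ₐ[ℝ] (V →L[ℝ] V)) (a : ℍ[ℝ]) (α : V [⋀^Fin k]→L[ℝ] ℂ) :
    complexQuatDer φ k a α = quatDer φ a α := rfl

theorem hasDerivAt_compContinuousLinearMap_expI {F : Type*} [NormedAddCommGroup F]
    [NormedSpace ℝ F] (φ : ℍ[ℝ] →ₐ[ℝ] (V →L[ℝ] V)) (α : V [⋀^Fin k]→L[ℝ] F) (θ : ℝ) :
    HasDerivAt (fun t : ℝ => α.compContinuousLinearMap (φ (star (expI t : ℍ[ℝ]))))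
      ((quatDer φ qI α).compContinuousLinearMap (φ (star (expI θ : ℍ[ℝ])))) θ := by
  have star_eq (t : ℝ) : star (expI t : ℍ[ℝ]) = Real.cos t • (1 : ℍ[ℝ]) - Real.sin t • qI := by
    ext <;> simp [expI]
  have hasDerivAt_star : HasDerivAt (fun t => φ (star (expI t : ℍ[ℝ])))
      (φ qI ∘L (-φ (star (expI θ : ℍ[ℝ])))) θ := by
    simp only [star_eq, map_sub, map_smul]
    refine (((Real.hasDerivAt_cos θ).smul_const (φ 1)).sub
      ((Real.hasDerivAt_sin θ).smul_const (φ qI))).congr_deriv ?_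
    rw [neg_sub, ← ContinuousLinearMap.mul_def, mul_sub, mul_smul_comm, mul_smul_comm, ← map_mul,
      ← map_mul, qI_mul_qI, mul_one, map_neg]
    module
  have h := ((hasFDerivAt_const α θ).continuousAlternatingMapCompContinuousLinearMap
    hasDerivAt_star.hasFDerivAt).hasDerivAt
  rw [ContinuousLinearMap.comp_zero, zero_add, ContinuousLinearMap.comp_apply,
    ContinuousLinearMap.toSpanSingleton_apply, one_smul, ContinuousLinearMap.comp_neg, map_neg,
    fderivCompContinuousLinearMap_comp_left] at h
  rwa [neg_neg] at h

theorem isDifferential_complexQuatDer :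
    IsDifferential (formRep p k) (complexQuatDer (quatActHom p) k) where
  hasDerivAt_expI α θ := hasDerivAt_compContinuousLinearMap_expI (quatActHom p) α θ
  conj q a α := by
    rw [formRep_apply, complexQuatDer_apply,
      quatDer_compContinuousLinearMap_unitary _ (Unitary.star_mem q.2), star_star, mul_assoc,
      mul_assoc, mul_assoc, Unitary.coe_star_mul_self, mul_one, ← mul_assoc,
      Unitary.coe_star_mul_self, one_mul]
    rfl
  commutator := quatDer_commutator (quatActHom p)

theorem mem_casimirSpace_quatActHom_iff {F : Type*} [NormedAddCommGroup F] [NormedSpace ℝ F]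
    {r : ℤ} {α : V [⋀^Fin k]→L[ℝ] F} : α ∈ casimirSpace (quatActHom p) r ↔
      α.compContinuousLinearMap (p.symm : (Fin n → ℍ[ℝ]) →L[ℝ] V) ∈
        casimirSpace (leftMulHom n) r := by
  refine ⟨compContinuousLinearMap_mem_casimirSpace fun a => ?_, fun h => ?_⟩
  · ext1 v
    simp [quatActHom]
  · convert compContinuousLinearMap_mem_casimirSpace (g := (p : V →L[ℝ] (Fin n → ℍ[ℝ])))
      (φ := quatActHom p) (fun a => ?_) h
    · ext v
      simp [Function.comp_def]
    · ext1 v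
      simp [quatActHom]

theorem mem_weightForms_iff {r : ℤ} (hr : -1 ≤ r) {α : V [⋀^Fin k]→L[ℝ] ℂ} :
    α ∈ weightForms p k r ↔ α.compContinuousLinearMap (p.symm : (Fin n → ℍ[ℝ]) →L[ℝ] V) ∈
      casimirSpace (leftMulHom n) r := by
  have := finiteDimensional_forms p k
  have := isSemisimpleRepresentation_formRep p (k := k)
  have h := (isDifferential_complexQuatDer p (k := k)).isotypic_eq_eigenspace hr
  rw [← mem_casimirSpace_quatActHom_iff, mem_casimirSpace_iff]
  refine (Submodule.ext_iff.1 h α).trans (Module.End.mem_eigenspace_iff.trans ?_)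
  rw [← Complex.coe_smul]
  push_cast
  rfl

theorem weightForms_eq_bot {r : ℤ} (hr : r < 0) : weightForms p k r = ⊥ :=
  isotypic_eq_bot hr

end FormRep

/-! ### The eigenspace bundles -/

section Bundle

variable {F : Type*} [NormedAddCommGroup F] [NormedSpace ℝ F] {n k : ℕ} {r s : ℤ}

/-- Right multiplication by a quaternionic matrix on `ℍⁿ`. -/
def rightMul (B : Matrix (Fin n) (Fin n) ℍ[ℝ]) : (Fin n → ℍ[ℝ]) →L[ℝ] (Fin n → ℍ[ℝ]) :=
  LinearMap.toContinuousLinearMap ((Matrix.vecMulLinear B).restrictScalars ℝ)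

theorem leftMulHom_comp_rightMul (a : ℍ[ℝ]) (B : Matrix (Fin n) (Fin n) ℍ[ℝ]) :
    leftMulHom n a ∘L rightMul B = rightMul B ∘L leftMulHom n a :=
  ContinuousLinearMap.ext fun v => ((Matrix.vecMulLinear B).map_smul a v).symm

theorem compContinuousLinearMap_sp1GL_mem_casimirSpace
    {g : (Fin n → ℍ[ℝ]) ≃L[ℝ] (Fin n → ℍ[ℝ])} (hg : g ∈ sp1GL n)
    {α : (Fin n → ℍ[ℝ]) [⋀^Fin k]→L[ℝ] F} (hα : α ∈ casimirSpace (leftMulHom n) r) :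
    α.compContinuousLinearMap (g : (Fin n → ℍ[ℝ]) →L[ℝ] (Fin n → ℍ[ℝ])) ∈
      casimirSpace (leftMulHom n) r := by
  obtain ⟨q, A, h⟩ := hg
  have g_eq : (g : (Fin n → ℍ[ℝ]) →L[ℝ] (Fin n → ℍ[ℝ])) =
      leftMulHom n q ∘L rightMul (A : Matrix (Fin n) (Fin n) ℍ[ℝ]) := ContinuousLinearMap.ext h
  rw [g_eq]
  exact compContinuousLinearMap_mem_casimirSpace
    (fun a => (leftMulHom_comp_rightMul a _).symm)
    (compContinuousLinearMap_unitary_mem_casimirSpace q.2 hα)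

variable {E : Type*} [NormedAddCommGroup E] [NormedSpace ℝ E]
  {M : Type*} [TopologicalSpace M] [ChartedSpace E M] [IsManifold 𝓘(ℝ, E) 1 M]
  (Q : Sp1GLStructure E M n)

theorem exists_mem_frames (x : M) : ∃ p, p ∈ Q.frames x :=
  let ⟨_, s, _, hx, hs, _⟩ := Q.exists_section x
  ⟨s x, hs x hx⟩

/-- The common generalization of the bundles `E_{k,r}` of complex-valued and of real-valued forms:
the `F`-valued forms that are eigenvectors of the Casimir operator of `Sp(1)`, for the eigenvalue
which belongs to the highest weight `r`. It is only meaningful for `r ≥ -1`. -/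
def casimirBundle (F : Type*) [NormedAddCommGroup F] [NormedSpace ℝ F] (k : ℕ) (r : ℤ) (x : M) :
    Submodule ℝ (TangentSpace 𝓘(ℝ, E) x [⋀^Fin k]→L[ℝ] F) where
  carrier := {α | ∀ p ∈ Q.frames x,
    α.compContinuousLinearMap (p.symm : (Fin n → ℍ[ℝ]) →L[ℝ] TangentSpace 𝓘(ℝ, E) x) ∈
      casimirSpace (leftMulHom n) r}
  add_mem' hα hβ p hp := add_mem (hα p hp) (hβ p hp)
  zero_mem' _ _ := zero_mem _
  smul_mem' c _ hα p hp := Submodule.smul_mem _ c (hα p hp)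

variable {Q} {x : M} {p : TangentSpace 𝓘(ℝ, E) x ≃L[ℝ] (Fin n → ℍ[ℝ])}

theorem mem_casimirBundle_iff (hp : p ∈ Q.frames x)
    {α : TangentSpace 𝓘(ℝ, E) x [⋀^Fin k]→L[ℝ] F} : α ∈ casimirBundle Q F k r x ↔
      α.compContinuousLinearMap (p.symm : (Fin n → ℍ[ℝ]) →L[ℝ] TangentSpace 𝓘(ℝ, E) x) ∈
        casimirSpace (leftMulHom n) r := by
  refine ⟨fun h => h p hp, fun h p' hp' => ?_⟩
  obtain ⟨g, hg, rfl⟩ := (Q.mem_iff x p' hp' p).1 hp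
  convert compContinuousLinearMap_sp1GL_mem_casimirSpace hg h using 1
  ext v
  simp [Function.comp_def]

theorem mem_casimirBundle_sup (hp : p ∈ Q.frames x)
    {α : TangentSpace 𝓘(ℝ, E) x [⋀^Fin k]→L[ℝ] F}
    (hα : α.compContinuousLinearMap (p.symm : (Fin n → ℍ[ℝ]) →L[ℝ] TangentSpace 𝓘(ℝ, E) x) ∈
      casimirSpace (leftMulHom n) r ⊔ casimirSpace (leftMulHom n) s) :
    α ∈ casimirBundle Q F k r x ⊔ casimirBundle Q F k s x := by
  have symm_comp (β : (Fin n → ℍ[ℝ]) [⋀^Fin k]→L[ℝ] F) : (β.compContinuousLinearMap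
      (p : TangentSpace 𝓘(ℝ, E) x →L[ℝ] (Fin n → ℍ[ℝ]))).compContinuousLinearMap
        (p.symm : (Fin n → ℍ[ℝ]) →L[ℝ] TangentSpace 𝓘(ℝ, E) x) = β := by
    ext v
    simp [Function.comp_def]
  obtain ⟨β, hβ, γ, hγ, h⟩ := Submodule.mem_sup.1 hα
  refine Submodule.mem_sup.2
    ⟨β.compContinuousLinearMap (p : TangentSpace 𝓘(ℝ, E) x →L[ℝ] (Fin n → ℍ[ℝ])), ?_,
      γ.compContinuousLinearMap (p : TangentSpace 𝓘(ℝ, E) x →L[ℝ] (Fin n → ℍ[ℝ])), ?_, ?_⟩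
  · rwa [mem_casimirBundle_iff hp, symm_comp]
  · rwa [mem_casimirBundle_iff hp, symm_comp]
  · refine (congrArg (fun δ => δ.compContinuousLinearMap
      (p : TangentSpace 𝓘(ℝ, E) x →L[ℝ] (Fin n → ℍ[ℝ]))) h).trans ?_
    ext v
    simp [Function.comp_def]

theorem disjoint_casimirBundle (hrs : r ≠ s) (hrs' : r + s + 2 ≠ 0) (x : M) :
    Disjoint (casimirBundle Q F k r x) (casimirBundle Q F k s x) := by
  obtain ⟨p, hp⟩ := exists_mem_frames Q x
  refine Submodule.disjoint_def.2 fun α hr hs => ?_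
  have comp_eq_zero := Submodule.disjoint_def.1
    (disjoint_casimirSpace (leftMulHom n) hrs hrs') _ (hr p hp) (hs p hp)
  ext v
  simpa [Function.comp_def] using congrArg (fun β => β (p ∘ v)) comp_eq_zero

theorem restrictScalars_bundleC (hr : -1 ≤ r) (x : M) :
    (bundleC Q k r x).restrictScalars ℝ = casimirBundle Q ℂ k r x := by
  refine le_antisymm ?_ fun α hα => ?_
  · rw [bundleC, Submodule.restrictScalars_iSup]
    refine iSup_le fun p => ?_
    rw [Submodule.restrictScalars_iSup]
    exact iSup_le fun hp α hα =>
      (mem_casimirBundle_iff hp).2 ((mem_weightForms_iff (V := E) p hr).1 hα)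
  · obtain ⟨p, hp⟩ := exists_mem_frames Q x
    exact Submodule.mem_iSup_of_mem p (Submodule.mem_iSup_of_mem hp
      ((mem_weightForms_iff (V := E) p hr).2 (hα p hp)))

theorem complexify_injective {V : Type*} [AddCommGroup V] [Module ℝ V] [TopologicalSpace V] :
    Function.Injective (complexify V k) := fun _ _ h =>
  ContinuousAlternatingMap.ext fun v => Complex.ofReal_injective (DFunLike.congr_fun h v)

theorem complexify_mem_casimirSpace_iff {V : Type*} [NormedAddCommGroup V] [NormedSpace ℝ V]
    {φ : ℍ[ℝ] →ₐ[ℝ] (V →L[ℝ] V)} {α : V [⋀^Fin k]→L[ℝ] ℝ} :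
    complexify V k α ∈ casimirSpace φ r ↔ α ∈ casimirSpace φ r := by
  rw [mem_casimirSpace_iff, mem_casimirSpace_iff, ← complexify_injective.eq_iff,
    map_smul]
  exact Eq.congr_left (casimir_compContinuousAlternatingMap φ Complex.ofRealCLM α)

theorem bundleR_eq_casimirBundle (hr : -1 ≤ r) (x : M) :
    bundleR Q k r x = casimirBundle Q ℝ k r x := by
  obtain ⟨p, hp⟩ := exists_mem_frames Q x
  ext α
  rw [bundleR, restrictScalars_bundleC hr, Submodule.mem_comap, mem_casimirBundle_iff hp,
    mem_casimirBundle_iff hp]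
  exact complexify_mem_casimirSpace_iff (V := Fin n → ℍ[ℝ])
    (α := α.compContinuousLinearMap (p.symm : (Fin n → ℍ[ℝ]) →L[ℝ] TangentSpace 𝓘(ℝ, E) x))

theorem bundleC_eq_bot (hr : r < 0) (x : M) : bundleC Q k r x = ⊥ := by
  simp only [bundleC, iSup_eq_bot]
  exact fun p _ => weightForms_eq_bot (V := E) p hr

theorem bundleR_eq_bot (hr : r < 0) (x : M) : bundleR Q k r x = ⊥ := by
  rw [bundleR, bundleC_eq_bot hr]
  exact LinearMap.ker_eq_bot.2 complexify_injective

end Bundle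

/-! ### Forms on the quaternionic line -/

section Line

variable {V : Type*} [NormedAddCommGroup V] [NormedSpace ℝ V]
  {F : Type*} [NormedAddCommGroup F] [NormedSpace ℝ F] {k : ℕ} {φ : ℍ[ℝ] →ₐ[ℝ] (V →L[ℝ] V)}

theorem mem_casimirSpace_sup_of_forall_mem {s : ℤ} (hs : s ≠ -1)
    (h : ∀ β : V [⋀^Fin k]→L[ℝ] F, β ∈ casimirSpace φ s) (ζ : V [⋀^Fin (k + 1)]→L[ℝ] F) :
    ζ ∈ casimirSpace φ (s + 1) ⊔ casimirSpace φ (s - 1) := by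
  have h' := alternatizeUncurryFin_mem_sup φ (T := ζ.curryLeft) hs fun _ => h _
  rw [ContinuousAlternatingMap.alternatizeUncurryFin_curryLeft,
    ← Nat.cast_smul_eq_nsmul ℝ] at h'
  exact (Submodule.smul_mem_iff _ (Nat.cast_ne_zero.2 k.succ_ne_zero)).1 h'

theorem mem_casimirSpace_zero (β : V [⋀^Fin 0]→L[ℝ] F) : β ∈ casimirSpace φ 0 := by
  have quatDer_eq_zero (a : ℍ[ℝ]) : quatDer φ a β = 0 := by
    ext v
    simp [quatDer_apply, lieDer_apply]
  simp [mem_casimirSpace_iff, casimir_apply, quatDer_eq_zero]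

theorem mem_casimirSpace_one_of_quatDer_quatDer {ι : Type*} [Fintype ι] [DecidableEq ι]
    {α : V [⋀^ι]→L[ℝ] F} (hI : quatDer φ qI (quatDer φ qI α) = -α)
    (hJ : quatDer φ qJ (quatDer φ qJ α) = -α) (hK : quatDer φ qK (quatDer φ qK α) = -α) :
    α ∈ casimirSpace φ 1 := by
  rw [mem_casimirSpace_iff, casimir_apply, hI, hJ, hK]
  push_cast
  module

theorem quatDer_quatDer_degree_one {a : ℍ[ℝ]} (ha : a * a = -1) (β : V [⋀^Fin 1]→L[ℝ] F) :
    quatDer φ a (quatDer φ a β) = -β := by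
  ext v
  have smul_smul_eq : φ a (φ a (v 0)) = (-1 : ℝ) • v 0 := by
    rw [← mul_apply_eq_comp, ← map_mul, ha, map_neg, map_one]
    simp
  simp only [quatDer_apply, lieDer_apply, Finset.univ_unique, Fin.default_eq_zero,
    Finset.sum_singleton, neg_neg, Function.update_self, Function.update_idem, smul_smul_eq]
  rw [β.map_update_smul, Function.update_eq_self, neg_one_smul]
  rfl

theorem mem_casimirSpace_one (β : V [⋀^Fin 1]→L[ℝ] F) : β ∈ casimirSpace φ 1 :=
  mem_casimirSpace_one_of_quatDer_quatDer (quatDer_quatDer_degree_one qI_mul_qI β)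
    (quatDer_quatDer_degree_one qJ_mul_qJ β) (quatDer_quatDer_degree_one qK_mul_qK β)

theorem lieDer_apply_of_pair {A : V →L[ℝ] V} (α : V [⋀^Fin 3]→L[ℝ] F) {v : Fin 3 → V}
    {i j l : Fin 3} (hij : i ≠ j) (hli : l ≠ i) (hlj : l ≠ j) {c d : ℝ}
    (hi : A (v i) = c • v j) (hj : A (v j) = d • v i) :
    lieDer A α v = -α (Function.update v l (A (v l))) := by
  have update_eq_zero {a b : Fin 3} (hab : a ≠ b) (t : ℝ) :
      α (Function.update v a (t • v b)) = 0 := by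
    rw [α.map_update_smul, α.map_eq_zero_of_eq _ _ hab, smul_zero]
    rw [Function.update_self, Function.update_of_ne hab.symm]
  rw [lieDer_apply, Finset.sum_eq_single l (fun m _ hm => ?_) (by simp)]
  obtain rfl | rfl : m = i ∨ m = j := by omega
  · rw [hi, update_eq_zero hij]
  · rw [hj, update_eq_zero hij.symm]

theorem lieDer_lieDer_apply_of_pair {A : V →L[ℝ] V} (hA : ∀ v, A (A v) = -v)
    (α : V [⋀^Fin 3]→L[ℝ] F) {v : Fin 3 → V} {i j l : Fin 3} (hij : i ≠ j) (hli : l ≠ i)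
    (hlj : l ≠ j) {c d : ℝ} (hi : A (v i) = c • v j) (hj : A (v j) = d • v i) :
    lieDer A (lieDer A α) v = -α v := by
  rw [lieDer_apply_of_pair _ hij hli hlj hi hj,
    lieDer_apply_of_pair α hij hli hlj (c := c) (d := d)]
  · rw [Function.update_self, Function.update_idem, hA, ← neg_one_smul ℝ (v l),
      α.map_update_smul, Function.update_eq_self, neg_one_smul, neg_neg]
  · rw [Function.update_of_ne hli.symm, Function.update_of_ne hlj.symm, hi]
  · rw [Function.update_of_ne hli.symm, Function.update_of_ne hlj.symm, hj]

/-- `σ` describes how multiplication by `u` permutes the lines spanned by `1, i, j, k`. -/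
theorem quatDer_quatDer_degree_three {u : ℍ[ℝ]} (hu : u * u = -1) (σ : Fin 4 → Fin 4)
    (hσ : ∀ f : Fin 3 → Fin 4, Function.Injective f →
      ∃ i j l, i ≠ j ∧ l ≠ i ∧ l ≠ j ∧ f j = σ (f i) ∧ f i = σ (f j))
    (hσu : ∀ a, ∃ c : ℝ, u * ![1, qI, qJ, qK] a = c • ![1, qI, qJ, qK] (σ a))
    (α : (Fin 1 → ℍ[ℝ]) [⋀^Fin 3]→L[ℝ] F) :
    quatDer (leftMulHom 1) u (quatDer (leftMulHom 1) u α) = -α := by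
  have sq_eq_neg (v : Fin 1 → ℍ[ℝ]) : leftMulHom 1 u (leftMulHom 1 u v) = -v := by
    rw [← mul_apply_eq_comp, ← map_mul, hu, map_neg, map_one]
    rfl
  choose c hc using hσu
  have leftMul_basis (b b' : (_ : Fin 1) × Fin 4) (hb : b'.2 = σ b.2) :
      leftMulHom 1 u (quatBasis 1 b) = c b.2 • quatBasis 1 b' := by
    funext m
    rw [leftMulHom_apply_apply, Pi.smul_apply, quatBasis_apply, quatBasis_apply,
      Subsingleton.elim b.1 m, Subsingleton.elim b'.1 m, Pi.single_eq_same, Pi.single_eq_same,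
      hb, hc]
  refine ContinuousAlternatingMap.toAlternatingMap_injective
    (Module.Basis.ext_alternating (quatBasis 1) fun f hf => ?_)
  have snd_injective : Function.Injective fun m => (f m).2 := fun m m' h =>
    hf (Sigma.ext (Subsingleton.elim _ _) (heq_of_eq h))
  obtain ⟨i, j, l, hij, hli, hlj, hj, hi⟩ := hσ _ snd_injective
  exact lieDer_lieDer_apply_of_pair (v := fun m => quatBasis 1 (f m)) sq_eq_neg α hij hli hlj
    (leftMul_basis (f i) (f j) hj) (leftMul_basis (f j) (f i) hi)

theorem mem_casimirSpace_one_of_degree_three (β : (Fin 1 → ℍ[ℝ]) [⋀^Fin 3]→L[ℝ] F) :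
    β ∈ casimirSpace (leftMulHom 1) 1 := by
  refine mem_casimirSpace_one_of_quatDer_quatDer
    (quatDer_quatDer_degree_three qI_mul_qI ![1, 0, 3, 2] (by decide) (fun a => ?_) β)
    (quatDer_quatDer_degree_three qJ_mul_qJ ![2, 3, 0, 1] (by decide) (fun a => ?_) β)
    (quatDer_quatDer_degree_three qK_mul_qK ![3, 2, 1, 0] (by decide) (fun a => ?_) β)
  · refine ⟨![1, -1, 1, -1] a, ?_⟩
    fin_cases a <;> simp [qI_mul_qI, qI_mul_qJ, qI_mul_qK]
  · refine ⟨![1, -1, -1, 1] a, ?_⟩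
    fin_cases a <;> simp [qJ_mul_qI, qJ_mul_qJ, qJ_mul_qK]
  · refine ⟨![1, 1, -1, -1] a, ?_⟩
    fin_cases a <;> simp [qK_mul_qI, qK_mul_qJ, qK_mul_qK]

theorem eq_zero_of_four_lt (hk : 4 < k) (β : (Fin 1 → ℍ[ℝ]) [⋀^Fin k]→L[ℝ] F) : β = 0 := by
  refine ContinuousAlternatingMap.toAlternatingMap_injective
    (Module.Basis.ext_alternating (quatBasis 1) fun f hf => ?_)
  have card_le := Fintype.card_le_of_injective f hf
  simp only [Fintype.card_fin, Fintype.card_sigma, Finset.sum_const, Finset.card_univ,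
    smul_eq_mul] at card_le
  omega

theorem eq_of_ne_zero_of_mem_casimirSpace {α : V [⋀^Fin k]→L[ℝ] F} {r s : ℤ} (hα : α ≠ 0)
    (hr : 0 ≤ r) (hs : 0 ≤ s) (hαr : α ∈ casimirSpace φ r) (hαs : α ∈ casimirSpace φ s) :
    r = s := by
  by_contra h
  exact hα (Submodule.disjoint_def.1 (disjoint_casimirSpace φ h (by omega)) α hαr hαs)

/-- In real dimension four there are so few types of forms that the types allowed by a single
nonzero `k`-form fill the whole space of `(k + 1)`-forms. -/
theorem mem_casimirSpace_sup_of_ne_zero {r : ℤ} (hr : 0 ≤ r)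
    {α : (Fin 1 → ℍ[ℝ]) [⋀^Fin k]→L[ℝ] F} (hα : α ∈ casimirSpace (leftMulHom 1) r) (hα₀ : α ≠ 0)
    (ζ : (Fin 1 → ℍ[ℝ]) [⋀^Fin (k + 1)]→L[ℝ] F) :
    ζ ∈ casimirSpace (leftMulHom 1) (r + 1) ⊔ casimirSpace (leftMulHom 1) (r - 1) := by
  match k, α, ζ with
  | 0, α, ζ =>
    obtain rfl := eq_of_ne_zero_of_mem_casimirSpace hα₀ hr le_rfl hα (mem_casimirSpace_zero α)
    exact mem_casimirSpace_sup_of_forall_mem (by decide) mem_casimirSpace_zero ζ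
  | 1, α, ζ =>
    obtain rfl := eq_of_ne_zero_of_mem_casimirSpace hα₀ hr zero_le_one hα (mem_casimirSpace_one α)
    exact mem_casimirSpace_sup_of_forall_mem (by decide) mem_casimirSpace_one ζ
  | 2, α, ζ =>
    obtain rfl | rfl : r = 2 ∨ r = 0 := by
      by_contra! h
      have h' := disjoint_casimirSpace_sup (F := F) (ι := Fin 2) (leftMulHom 1) h.1 (by omega) h.2
        (by omega)
      exact hα₀ (Submodule.disjoint_def.1 h' α hα
        (mem_casimirSpace_sup_of_forall_mem (by decide) mem_casimirSpace_one α))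
    · exact Submodule.mem_sup_right (mem_casimirSpace_one_of_degree_three ζ)
    · exact Submodule.mem_sup_left (mem_casimirSpace_one_of_degree_three ζ)
  | 3, α, ζ =>
    obtain rfl := eq_of_ne_zero_of_mem_casimirSpace hα₀ hr zero_le_one hα
      (mem_casimirSpace_one_of_degree_three α)
    exact mem_casimirSpace_sup_of_forall_mem (by decide) mem_casimirSpace_one_of_degree_three ζ
  | k + 4, _, ζ =>
    rw [eq_zero_of_four_lt (by omega) ζ]
    exact zero_mem _

end Line

/-! ### The exterior derivative in charts -/

section Charts

open Filter Topology

set_option synthInstance.maxHeartbeats 200000 in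
-- Finding the norm on `E →L[ℝ] E [⋀^Fin k]→L[ℝ] F` is slow.
theorem contDiffAt_extDeriv {E : Type*} [NormedAddCommGroup E] [NormedSpace ℝ E]
    {F : Type*} [NormedAddCommGroup F] [NormedSpace ℝ F] {k : ℕ} {f : E → E [⋀^Fin k]→L[ℝ] F}
    {y : E} (hf : ContDiffAt ℝ ∞ f y) : ContDiffAt ℝ ∞ (extDeriv f) y :=
  (ContinuousAlternatingMap.alternatizeUncurryFinCLM ℝ E F (n := k)).contDiff.contDiffAt.comp y
    (hf.fderiv_right (by simp))

variable {E : Type*} [NormedAddCommGroup E] [NormedSpace ℝ E]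
  {M : Type*} [TopologicalSpace M] [ChartedSpace E M]
  {F : Type*} [NormedAddCommGroup F] [NormedSpace ℝ F] {k : ℕ}

theorem compContinuousLinearMap_comp {V W : Type*} [NormedAddCommGroup V] [NormedSpace ℝ V]
    [NormedAddCommGroup W] [NormedSpace ℝ W] (α : E [⋀^Fin k]→L[ℝ] F) (f : V →L[ℝ] E)
    (g : W →L[ℝ] V) : α.compContinuousLinearMap (f ∘L g) =
      (α.compContinuousLinearMap f).compContinuousLinearMap g := rfl

/-- The derivative at `p` of the chart around `x`, as an endomorphism of the model space, which has
a norm, rather than as a map from the tangent space, which has none. -/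
def chartDeriv (x p : M) : E →L[ℝ] E :=
  mfderiv 𝓘(ℝ, E) 𝓘(ℝ, E) (extChartAt 𝓘(ℝ, E) x) p

/-- The derivative at `y` of the inverse of the chart around `x`, as an endomorphism of the model
space. -/
def chartSymmDeriv (x : M) (y : E) : E →L[ℝ] E :=
  mfderiv 𝓘(ℝ, E) 𝓘(ℝ, E) (extChartAt 𝓘(ℝ, E) x).symm y

/-- The value of a form at a point, as a form on the model space. -/
def DForm.val (α : DForm E M F k) (p : M) : E [⋀^Fin k]→L[ℝ] F := α p

theorem DForm.inChart_eq (α : DForm E M F k) (x : M) (y : E) :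
    α.inChart x y = (α.val ((extChartAt 𝓘(ℝ, E) x).symm y)).compContinuousLinearMap
      (chartSymmDeriv x y) := rfl

theorem DForm.val_d (α : DForm E M F k) (x : M) :
    α.d.val x = (extDeriv (α.inChart x) (extChartAt 𝓘(ℝ, E) x x)).compContinuousLinearMap
      (chartDeriv x x) := rfl

theorem eventually_mem_target {x : M} {y : E} (hy : y ∈ (extChartAt 𝓘(ℝ, E) x).target) :
    ∀ᶠ z in 𝓝 y, z ∈ (extChartAt 𝓘(ℝ, E) x).target :=
  (isOpen_extChartAt_target x).mem_nhds hy

theorem DForm.IsSmooth.contDiffAt {α : DForm E M F k} (hα : α.IsSmooth) {x : M} {y : E}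
    (hy : y ∈ (extChartAt 𝓘(ℝ, E) x).target) : ContDiffAt ℝ ∞ (α.inChart x) y :=
  (hα x).contDiffAt (eventually_mem_target hy)

variable [IsManifold 𝓘(ℝ, E) ∞ M]

theorem chartDeriv_comp_chartSymmDeriv {x : M} {y : E} (hy : y ∈ (extChartAt 𝓘(ℝ, E) x).target) :
    chartDeriv x ((extChartAt 𝓘(ℝ, E) x).symm y) ∘L chartSymmDeriv x y = .id ℝ E := by
  have h := mfderiv_extChartAt_comp_mfderivWithin_extChartAt_symm hy
  rwa [modelWithCornersSelf_coe, range_id, mfderivWithin_univ] at h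

theorem chartSymmDeriv_comp_chartDeriv {x : M} {y : E} (hy : y ∈ (extChartAt 𝓘(ℝ, E) x).target) :
    chartSymmDeriv x y ∘L chartDeriv x ((extChartAt 𝓘(ℝ, E) x).symm y) = .id ℝ E := by
  have h := mfderivWithin_extChartAt_symm_comp_mfderiv_extChartAt hy
  rwa [modelWithCornersSelf_coe, range_id, mfderivWithin_univ] at h

theorem DForm.inChart_comp_chartDeriv (α : DForm E M F k) {x p : M}
    (hp : p ∈ (extChartAt 𝓘(ℝ, E) x).source) :
    (α.inChart x (extChartAt 𝓘(ℝ, E) x p)).compContinuousLinearMap (chartDeriv x p) = α.val p := by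
  have h := chartSymmDeriv_comp_chartDeriv ((extChartAt 𝓘(ℝ, E) x).map_source hp)
  rw [(extChartAt 𝓘(ℝ, E) x).left_inv hp] at h
  rw [DForm.inChart_eq, (extChartAt 𝓘(ℝ, E) x).left_inv hp,
    ← compContinuousLinearMap_comp, h]
  rfl

theorem mdifferentiableAt_extChartAt_symm {x : M} {y : E}
    (hy : y ∈ (extChartAt 𝓘(ℝ, E) x).target) :
    MDifferentiableAt 𝓘(ℝ, E) 𝓘(ℝ, E) (extChartAt 𝓘(ℝ, E) x).symm y := by
  have h := mdifferentiableWithinAt_extChartAt_symm hy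
  rwa [modelWithCornersSelf_coe, range_id, mdifferentiableWithinAt_univ] at h

theorem contDiffAt_coordChange {x x' : M} {y : E} (hy : y ∈ (extChartAt 𝓘(ℝ, E) x).target)
    (hy' : (extChartAt 𝓘(ℝ, E) x).symm y ∈ (extChartAt 𝓘(ℝ, E) x').source) :
    ContDiffAt ℝ ∞ (extChartAt 𝓘(ℝ, E) x' ∘ (extChartAt 𝓘(ℝ, E) x).symm) y := by
  have h := contDiffWithinAt_ext_coord_change (I := 𝓘(ℝ, E)) (n := ∞) x' x (y := y)
    (by rw [PartialEquiv.trans_source]; exact ⟨hy, hy'⟩)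
  rwa [modelWithCornersSelf_coe, range_id, contDiffWithinAt_univ] at h

theorem fderiv_coordChange {x x' : M} {y : E} (hy : y ∈ (extChartAt 𝓘(ℝ, E) x).target)
    (hy' : (extChartAt 𝓘(ℝ, E) x).symm y ∈ (extChartAt 𝓘(ℝ, E) x').source) :
    fderiv ℝ (extChartAt 𝓘(ℝ, E) x' ∘ (extChartAt 𝓘(ℝ, E) x).symm) y =
      chartDeriv x' ((extChartAt 𝓘(ℝ, E) x).symm y) ∘L chartSymmDeriv x y := by
  rw [extChartAt_source] at hy'
  rw [← mfderiv_eq_fderiv]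
  exact mfderiv_comp y (mdifferentiableAt_extChartAt hy') (mdifferentiableAt_extChartAt_symm hy)

theorem DForm.inChart_coordChange (α : DForm E M F k) {x x' : M} {y : E}
    (hy : y ∈ (extChartAt 𝓘(ℝ, E) x).target)
    (hy' : (extChartAt 𝓘(ℝ, E) x).symm y ∈ (extChartAt 𝓘(ℝ, E) x').source) :
    α.inChart x y =
      (α.inChart x' ((extChartAt 𝓘(ℝ, E) x' ∘ (extChartAt 𝓘(ℝ, E) x).symm) y)
        ).compContinuousLinearMap
        (fderiv ℝ (extChartAt 𝓘(ℝ, E) x' ∘ (extChartAt 𝓘(ℝ, E) x).symm) y) := by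
  rw [fderiv_coordChange hy hy', compContinuousLinearMap_comp,
    Function.comp_apply, α.inChart_comp_chartDeriv hy', DForm.inChart_eq]

theorem DForm.IsSmooth.inChart_d {α : DForm E M F k} (hα : α.IsSmooth) {x : M} {y : E}
    (hy : y ∈ (extChartAt 𝓘(ℝ, E) x).target) : α.d.inChart x y = extDeriv (α.inChart x) y := by
  set p := (extChartAt 𝓘(ℝ, E) x).symm y
  have hpy : (extChartAt 𝓘(ℝ, E) x).symm y ∈ (extChartAt 𝓘(ℝ, E) p).source :=
    mem_extChartAt_source p
  have pullback : α.inChart x =ᶠ[𝓝 y] fun z =>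
      (α.inChart p ((extChartAt 𝓘(ℝ, E) p ∘ (extChartAt 𝓘(ℝ, E) x).symm) z)
        ).compContinuousLinearMap
        (fderiv ℝ (extChartAt 𝓘(ℝ, E) p ∘ (extChartAt 𝓘(ℝ, E) x).symm) z) := by
    filter_upwards [eventually_mem_target hy,
      (mdifferentiableAt_extChartAt_symm hy).continuousAt.eventually
        ((isOpen_extChartAt_source p).mem_nhds hpy)] with z hz hpz
    exact α.inChart_coordChange hz hpz
  have differentiableAt : DifferentiableAt ℝ (α.inChart p)
      ((extChartAt 𝓘(ℝ, E) p ∘ (extChartAt 𝓘(ℝ, E) x).symm) y) :=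
    (hα.contDiffAt (mem_extChartAt_target p)).differentiableAt (by simp)
  rw [pullback.extDeriv_eq, extDeriv_pullback differentiableAt (contDiffAt_coordChange hy hpy)
      (by rw [minSmoothness_of_isRCLikeNormedField]; exact WithTop.coe_le_coe.2 le_top),
    fderiv_coordChange hy hpy, DForm.inChart_eq, DForm.val_d]
  rfl

theorem DForm.IsSmooth.d {α : DForm E M F k} (hα : α.IsSmooth) : α.d.IsSmooth := fun x =>
  ContDiffOn.congr (f := extDeriv (α.inChart x))
    (fun _ hy => (contDiffAt_extDeriv (hα.contDiffAt hy)).contDiffWithinAt) fun _ hy =>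
      hα.inChart_d hy

end Charts

/-! ### The exterior derivative in a moving frame -/

section LinearFrame

open Filter Topology

variable {V : Type*} [NormedAddCommGroup V] [NormedSpace ℝ V]
  {E : Type*} [NormedAddCommGroup E] [NormedSpace ℝ E]
  {F : Type*} [NormedAddCommGroup F] [NormedSpace ℝ F] {k : ℕ}

/-- The covariant derivative of a form whose components in a moving frame are `β` and have the
derivatives `dβ`, for a connection with connection form `A`. -/
def covDer (A : V →L[ℝ] V →L[ℝ] V) (β : V [⋀^Fin k]→L[ℝ] F) (dβ : V →L[ℝ] V [⋀^Fin k]→L[ℝ] F) :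
    V →L[ℝ] V [⋀^Fin k]→L[ℝ] F :=
  dβ - β.fderivCompContinuousLinearMap (.id ℝ V) ∘L A

theorem covDer_apply (A : V →L[ℝ] V →L[ℝ] V) (β : V [⋀^Fin k]→L[ℝ] F)
    (dβ : V →L[ℝ] V [⋀^Fin k]→L[ℝ] F) (w : V) : covDer A β dβ w = dβ w + lieDer (A w) β := by
  rw [lieDer_eq, ← sub_eq_add_neg]
  rfl

theorem extDeriv_compContinuousLinearMap_eq_alternatizeUncurryFin {f : E → E [⋀^Fin k]→L[ℝ] F}
    {Z : E → V →L[ℝ] E} {y : E} (hf : DifferentiableAt ℝ f y) (hZ : DifferentiableAt ℝ Z y)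
    (A : V →L[ℝ] V →L[ℝ] V)
    (hA : ∀ w v, fderiv ℝ Z y (Z y w) v - Z y (A w v) = fderiv ℝ Z y (Z y v) w - Z y (A v w)) :
    (extDeriv f y).compContinuousLinearMap (Z y) =
      alternatizeUncurryFin (covDer A ((f y).compContinuousLinearMap (Z y))
        (fderiv ℝ (fun z => (f z).compContinuousLinearMap (Z z)) y ∘L Z y)) := by
  let torsionFree : V →L[ℝ] V →L[ℝ] E :=
    fderiv ℝ Z y ∘L Z y - ContinuousLinearMap.compL ℝ V V E (Z y) ∘L A
  have covDer_eq : covDer A ((f y).compContinuousLinearMap (Z y))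
      (fderiv ℝ (fun z => (f z).compContinuousLinearMap (Z z)) y ∘L Z y) =
      ContinuousAlternatingMap.compContinuousLinearMapCLM (Z y) ∘L fderiv ℝ f y ∘L Z y +
        (f y).fderivCompContinuousLinearMap (Z y) ∘L torsionFree := by
    ext1 w
    have apply_w : torsionFree w = fderiv ℝ Z y (Z y w) - Z y ∘L A w := rfl
    rw [covDer_apply, fderiv_continuousAlternatingMapCompContinuousLinearMap hf hZ]
    simp only [add_apply, ContinuousLinearMap.comp_apply, apply_w, map_sub,
      fderivCompContinuousLinearMap_comp_right, add_assoc, sub_neg_eq_add]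
  rw [covDer_eq, alternatizeUncurryFin_add,
    ContinuousAlternatingMap.alternatizeUncurryFin_fderivCompContinuousLinearMap_eq_zero _ _ hA,
    add_zero, extDeriv]
  ext v
  simp +unfoldPartialApp [alternatizeUncurryFin_apply, Fin.removeNth, Function.comp_def]

theorem differentiableAt_of_forall_apply [FiniteDimensional ℝ V] {G : Type*}
    [NormedAddCommGroup G] [NormedSpace ℝ G] {Z : G → V →L[ℝ] E} {y : G}
    (hZ : ∀ v, DifferentiableAt ℝ (fun z => Z z v) y) : DifferentiableAt ℝ Z y := by
  let b := Module.finBasis ℝ V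
  let c (i) : V →L[ℝ] ℝ := LinearMap.toContinuousLinearMap (b.coord i)
  have Z_eq : Z = fun z => ∑ i, ContinuousLinearMap.smulRightL ℝ V E (c i) (Z z (b i)) := by
    funext z
    ext v
    conv_lhs => rw [← b.sum_repr v, map_sum]
    simp [c]
  rw [Z_eq]
  exact DifferentiableAt.fun_sum fun i _ =>
    (ContinuousLinearMap.smulRightL ℝ V E (c i)).differentiableAt.comp y (hZ (b i))

theorem fderiv_mem_of_eventually_mem {β : E → F} {y : E} (hβ : DifferentiableAt ℝ β y)
    {S : Submodule ℝ F} (hS : IsClosed (S : Set F)) (h : ∀ᶠ z in 𝓝 y, β z ∈ S) (u : E) :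
    fderiv ℝ β y u ∈ S := by
  have := hS
  have quotient_eq_zero : S.mkQL ∘ β =ᶠ[𝓝 y] fun _ => 0 :=
    h.mono fun z hz => (Submodule.Quotient.mk_eq_zero S).2 hz
  have fderiv_eq := quotient_eq_zero.fderiv_eq (𝕜 := ℝ)
  rw [fderiv_comp y S.mkQL.differentiableAt hβ, S.mkQL.fderiv, fderiv_const_apply] at fderiv_eq
  exact (Submodule.Quotient.mk_eq_zero S).1 (DFunLike.congr_fun fderiv_eq u)

end LinearFrame

section Frame

open Filter Topology VectorField

variable {V : Type*} [NormedAddCommGroup V] [NormedSpace ℝ V]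
  {E : Type*} [NormedAddCommGroup E] [NormedSpace ℝ E]
  {M : Type*} [TopologicalSpace M] [ChartedSpace E M]
  {F : Type*} [NormedAddCommGroup F] [NormedSpace ℝ F] {k : ℕ}
  {s : ∀ p : M, TangentSpace 𝓘(ℝ, E) p ≃L[ℝ] V} {x : M}

/-- The inverse of a frame, with values in the model space. -/
def frameInv (s : ∀ p : M, TangentSpace 𝓘(ℝ, E) p ≃L[ℝ] V) (p : M) : V →L[ℝ] E :=
  ((s p).symm : V →L[ℝ] TangentSpace 𝓘(ℝ, E) p)

/-- The inverse of a frame, read in the chart around `x`. -/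
def frameInChart (s : ∀ p : M, TangentSpace 𝓘(ℝ, E) p ≃L[ℝ] V) (x : M) (y : E) : V →L[ℝ] E :=
  chartDeriv x ((extChartAt 𝓘(ℝ, E) x).symm y) ∘L frameInv s ((extChartAt 𝓘(ℝ, E) x).symm y)

/-- The vector field given by a frame and a constant vector, pulled back to the chart
around `x`. -/
def frameField (s : ∀ p : M, TangentSpace 𝓘(ℝ, E) p ≃L[ℝ] V) (x : M) (v : V) : E → E :=
  mpullbackWithin 𝓘(ℝ, E) 𝓘(ℝ, E) (extChartAt 𝓘(ℝ, E) x).symm (fun p => (s p).symm v)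
    (range 𝓘(ℝ, E))

/-- The Lie bracket at `x` of the vector fields given by a frame and two constant vectors. -/
def frameBracket (s : ∀ p : M, TangentSpace 𝓘(ℝ, E) p ≃L[ℝ] V) (x : M) (w v : V) : E :=
  mlieBracket 𝓘(ℝ, E) (fun p => (s p).symm w) (fun p => (s p).symm v) x

theorem frameInChart_extChartAt_self (s : ∀ p : M, TangentSpace 𝓘(ℝ, E) p ≃L[ℝ] V) (x : M) :
    frameInChart s x (extChartAt 𝓘(ℝ, E) x x) = chartDeriv x x ∘L frameInv s x := by
  rw [frameInChart, extChartAt_to_inv]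

variable [IsManifold 𝓘(ℝ, E) ∞ M]

theorem inChart_comp_frameInChart (α : DForm E M F k)
    (s : ∀ p : M, TangentSpace 𝓘(ℝ, E) p ≃L[ℝ] V) {y : E}
    (hy : y ∈ (extChartAt 𝓘(ℝ, E) x).target) :
    (α.inChart x y).compContinuousLinearMap (frameInChart s x y) =
      (α.val ((extChartAt 𝓘(ℝ, E) x).symm y)).compContinuousLinearMap
        (frameInv s ((extChartAt 𝓘(ℝ, E) x).symm y)) := by
  rw [← α.inChart_comp_chartDeriv ((extChartAt 𝓘(ℝ, E) x).map_target hy),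
    (extChartAt 𝓘(ℝ, E) x).right_inv hy]
  rfl

theorem inverse_chartSymmDeriv {y : E} (hy : y ∈ (extChartAt 𝓘(ℝ, E) x).target) :
    (chartSymmDeriv x y).inverse = chartDeriv x ((extChartAt 𝓘(ℝ, E) x).symm y) :=
  ContinuousLinearMap.inverse_eq (chartSymmDeriv_comp_chartDeriv hy)
    (chartDeriv_comp_chartSymmDeriv hy)

theorem frameField_eventuallyEq (s : ∀ p : M, TangentSpace 𝓘(ℝ, E) p ≃L[ℝ] V) (x : M) (v : V) :
    frameField s x v =ᶠ[𝓝 (extChartAt 𝓘(ℝ, E) x x)] fun y => frameInChart s x y v := by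
  filter_upwards [eventually_mem_target (mem_extChartAt_target x)] with y hy
  rw [frameInChart, ← inverse_chartSymmDeriv hy, frameField, mpullbackWithin_apply,
    modelWithCornersSelf_coe, range_id, mfderivWithin_univ]
  rfl

theorem chartDeriv_frameBracket (s : ∀ p : M, TangentSpace 𝓘(ℝ, E) p ≃L[ℝ] V) (x : M) (w v : V) :
    chartDeriv x x (frameBracket s x w v) =
      lieBracket ℝ (frameField s x w) (frameField s x v) (extChartAt 𝓘(ℝ, E) x x) := by
  have bracket_eq : frameBracket s x w v =
      (chartDeriv x x).inverse (lieBracketWithin ℝ (frameField s x w) (frameField s x v)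
        ((extChartAt 𝓘(ℝ, E) x).symm ⁻¹' univ ∩ range 𝓘(ℝ, E)) (extChartAt 𝓘(ℝ, E) x x)) := rfl
  have right_inv := chartDeriv_comp_chartSymmDeriv (mem_extChartAt_target (I := 𝓘(ℝ, E)) x)
  have left_inv := chartSymmDeriv_comp_chartDeriv (mem_extChartAt_target (I := 𝓘(ℝ, E)) x)
  rw [extChartAt_to_inv] at right_inv left_inv
  rw [bracket_eq, preimage_univ, univ_inter, modelWithCornersSelf_coe, range_id,
    lieBracketWithin_univ, ContinuousLinearMap.inverse_eq right_inv left_inv,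
    ← ContinuousLinearMap.comp_apply, right_inv, ContinuousLinearMap.id_apply]

variable [CompleteSpace E]

/-- The covariant derivative in the direction given by a frame and the constant vector `w` of the
vector field given by that frame and the constant vector `v`, in the model space. -/
def frameCov (cov : CovariantDerivative 𝓘(ℝ, E) E (TangentSpace 𝓘(ℝ, E) : M → Type _))
    (s : ∀ p : M, TangentSpace 𝓘(ℝ, E) p ≃L[ℝ] V) (x : M) (w v : V) : E :=
  cov (fun y => (s y).symm v) x ((s x).symm w)

theorem frameCov_sub_frameCov [FiniteDimensional ℝ E]
    {cov : CovariantDerivative 𝓘(ℝ, E) E (TangentSpace 𝓘(ℝ, E) : M → Type _)}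
    (hcov : cov.torsion = 0)
    (hs : ∀ v, MDifferentiableAt 𝓘(ℝ, E) 𝓘(ℝ, E).tangent
      (fun p => (⟨p, (s p).symm v⟩ : TangentBundle 𝓘(ℝ, E) M)) x) (w v : V) :
    frameCov cov s x w v - frameCov cov s x v w = frameBracket s x w v :=
  cov.torsion_eq_zero_iff.1 hcov (hs w) (hs v)

variable [FiniteDimensional ℝ V]

theorem differentiableAt_frameInChart
    (hs : ∀ v, MDifferentiableAt 𝓘(ℝ, E) 𝓘(ℝ, E).tangent
      (fun p => (⟨p, (s p).symm v⟩ : TangentBundle 𝓘(ℝ, E) M)) x) :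
    DifferentiableAt ℝ (frameInChart s x) (extChartAt 𝓘(ℝ, E) x x) := by
  refine differentiableAt_of_forall_apply fun v => ?_
  have h : DifferentiableWithinAt ℝ (frameField s x v)
      ((extChartAt 𝓘(ℝ, E) x).symm ⁻¹' univ ∩ range 𝓘(ℝ, E)) (extChartAt 𝓘(ℝ, E) x x) :=
    ((hs v).mdifferentiableWithinAt (s := univ)
      ).differentiableWithinAt_mpullbackWithin_vectorField
  rw [preimage_univ, univ_inter, modelWithCornersSelf_coe, range_id,
    differentiableWithinAt_univ] at h
  exact h.congr_of_eventuallyEq (frameField_eventuallyEq s x v).symm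

theorem chartDeriv_frameBracket_eq_sub
    (hs : ∀ v, MDifferentiableAt 𝓘(ℝ, E) 𝓘(ℝ, E).tangent
      (fun p => (⟨p, (s p).symm v⟩ : TangentBundle 𝓘(ℝ, E) M)) x) (w v : V) :
    chartDeriv x x (frameBracket s x w v) =
      fderiv ℝ (frameInChart s x) (extChartAt 𝓘(ℝ, E) x x)
          (frameInChart s x (extChartAt 𝓘(ℝ, E) x x) w) v -
        fderiv ℝ (frameInChart s x) (extChartAt 𝓘(ℝ, E) x x)
          (frameInChart s x (extChartAt 𝓘(ℝ, E) x x) v) w := by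
  have fderiv_apply (v : V) (u : E) :
      fderiv ℝ (fun y => frameInChart s x y v) (extChartAt 𝓘(ℝ, E) x x) u =
        fderiv ℝ (frameInChart s x) (extChartAt 𝓘(ℝ, E) x x) u v := by
    rw [fderiv_clm_apply (differentiableAt_frameInChart hs) (differentiableAt_const v)]
    simp
  rw [chartDeriv_frameBracket, lieBracket, (frameField_eventuallyEq s x w).fderiv_eq,
    (frameField_eventuallyEq s x v).fderiv_eq, (frameField_eventuallyEq s x w).self_of_nhds,
    (frameField_eventuallyEq s x v).self_of_nhds, fderiv_apply, fderiv_apply]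

variable [FiniteDimensional ℝ E]
  {cov : CovariantDerivative 𝓘(ℝ, E) E (TangentSpace 𝓘(ℝ, E) : M → Type _)}
  {A : V →L[ℝ] V →L[ℝ] V}

theorem fderiv_frameInChart_sub_comm (hcov : cov.torsion = 0)
    (hs : ∀ v, MDifferentiableAt 𝓘(ℝ, E) 𝓘(ℝ, E).tangent
      (fun p => (⟨p, (s p).symm v⟩ : TangentBundle 𝓘(ℝ, E) M)) x)
    (hA : ∀ w v, frameInv s x (A w v) = frameCov cov s x w v) (w v : V) :
    fderiv ℝ (frameInChart s x) (extChartAt 𝓘(ℝ, E) x x)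
          (frameInChart s x (extChartAt 𝓘(ℝ, E) x x) w) v -
        frameInChart s x (extChartAt 𝓘(ℝ, E) x x) (A w v) =
      fderiv ℝ (frameInChart s x) (extChartAt 𝓘(ℝ, E) x x)
          (frameInChart s x (extChartAt 𝓘(ℝ, E) x x) v) w -
        frameInChart s x (extChartAt 𝓘(ℝ, E) x x) (A v w) := by
  have bracket_eq : chartDeriv x x (frameBracket s x w v) =
      frameInChart s x (extChartAt 𝓘(ℝ, E) x x) (A w v) -
        frameInChart s x (extChartAt 𝓘(ℝ, E) x x) (A v w) := by
    rw [← frameCov_sub_frameCov hcov hs, map_sub, frameInChart_extChartAt_self,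
      ContinuousLinearMap.comp_apply, ContinuousLinearMap.comp_apply, hA, hA]
  rw [chartDeriv_frameBracket_eq_sub hs] at bracket_eq
  exact sub_eq_sub_iff_sub_eq_sub.1 bracket_eq

theorem exists_d_comp_frameInv {α : DForm E M F k} (hα : α.IsSmooth) (hcov : cov.torsion = 0)
    (hs : ∀ v, MDifferentiableAt 𝓘(ℝ, E) 𝓘(ℝ, E).tangent
      (fun p => (⟨p, (s p).symm v⟩ : TangentBundle 𝓘(ℝ, E) M)) x)
    (hA : ∀ w v, frameInv s x (A w v) = frameCov cov s x w v)
    {S : Submodule ℝ (V [⋀^Fin k]→L[ℝ] F)} (hS : IsClosed (S : Set (V [⋀^Fin k]→L[ℝ] F)))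
    (hAS : ∀ w, ∀ γ ∈ S, lieDer (A w) γ ∈ S)
    (hαS : ∀ᶠ p in 𝓝 x, (α.val p).compContinuousLinearMap (frameInv s p) ∈ S) :
    ∃ T : V →L[ℝ] V [⋀^Fin k]→L[ℝ] F, (∀ w, T w ∈ S) ∧
      (α.d.val x).compContinuousLinearMap (frameInv s x) = alternatizeUncurryFin T := by
  have hx := mem_extChartAt_target (I := 𝓘(ℝ, E)) x
  have form_differentiableAt := (hα.contDiffAt hx).differentiableAt (by simp)
  have frame_differentiableAt := differentiableAt_frameInChart hs
  have components_mem : ∀ᶠ y in 𝓝 (extChartAt 𝓘(ℝ, E) x x),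
      (α.inChart x y).compContinuousLinearMap (frameInChart s x y) ∈ S := by
    have tendsto_symm := (mdifferentiableAt_extChartAt_symm hx).continuousAt.tendsto
    rw [extChartAt_to_inv] at tendsto_symm
    filter_upwards [eventually_mem_target hx, tendsto_symm.eventually hαS] with y hy h
    rwa [inChart_comp_frameInChart α s hy]
  have extDeriv_eq := extDeriv_compContinuousLinearMap_eq_alternatizeUncurryFin
    form_differentiableAt frame_differentiableAt A (fderiv_frameInChart_sub_comm hcov hs hA)
  refine ⟨_, fun w => ?_, Eq.trans ?_ extDeriv_eq⟩
  · rw [covDer_apply]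
    exact S.add_mem (fderiv_mem_of_eventually_mem
      (form_differentiableAt.continuousAlternatingMapCompContinuousLinearMap
        frame_differentiableAt) hS components_mem _) (hAS _ _ components_mem.self_of_nhds)
  · rw [DForm.val_d, ← compContinuousLinearMap_comp, ← frameInChart_extChartAt_self]

end Frame

/-! ### The exterior derivative of sections of the eigenspace bundles -/

section Main

open Topology

variable {F : Type*} [NormedAddCommGroup F] [NormedSpace ℝ F] {n k : ℕ} {r : ℤ}

theorem lieDer_mem_casimirSpace_of_mem_sp1glAlgebra {C : (Fin n → ℍ[ℝ]) →L[ℝ] (Fin n → ℍ[ℝ])}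
    (hC : ⇑C ∈ sp1glAlgebra n) {α : (Fin n → ℍ[ℝ]) [⋀^Fin k]→L[ℝ] F}
    (hα : α ∈ casimirSpace (leftMulHom n) r) : lieDer C α ∈ casimirSpace (leftMulHom n) r := by
  obtain ⟨a, B, ha, h⟩ := hC
  have C_eq : C = leftMulHom n a + rightMul B := ContinuousLinearMap.ext h
  rw [C_eq, map_add, add_apply, ← quatDer_apply]
  exact add_mem (quatDer_mem_casimirSpace ha hα)
    (lieDer_mem_casimirSpace (fun a => leftMulHom_comp_rightMul a B) hα)

theorem isClosed_casimirSpace {V : Type*} [NormedAddCommGroup V] [NormedSpace ℝ V]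
    (φ : ℍ[ℝ] →ₐ[ℝ] (V →L[ℝ] V)) (r : ℤ) :
    IsClosed {α : V [⋀^Fin k]→L[ℝ] F | α ∈ casimirSpace φ r} := by
  simp only [mem_casimirSpace_iff]
  exact isClosed_eq (casimir φ).continuous (continuous_const_smul _)

theorem exists_clm_of_mem_sp1glAlgebra {V : Type*} [NormedAddCommGroup V] [NormedSpace ℝ V]
    [FiniteDimensional ℝ V] {f : V → (Fin n → ℍ[ℝ]) → (Fin n → ℍ[ℝ])}
    (hf : ∀ w, f w ∈ sp1glAlgebra n) (map_add : ∀ w w' v, f (w + w') v = f w v + f w' v)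
    (map_smul : ∀ (c : ℝ) w v, f (c • w) v = c • f w v) :
    ∃ A : V →L[ℝ] (Fin n → ℍ[ℝ]) →L[ℝ] (Fin n → ℍ[ℝ]), ∀ w, ⇑(A w) = f w := by
  have exists_clm (w : V) : ∃ C : (Fin n → ℍ[ℝ]) →L[ℝ] (Fin n → ℍ[ℝ]), ⇑C = f w :=
    let ⟨a, B, _, h⟩ := hf w
    ⟨leftMul n a + rightMul B, funext fun v => (h v).symm⟩
  choose C hC using exists_clm
  exact ⟨LinearMap.toContinuousLinearMap
    { toFun := C
      map_add' := fun w w' => ContinuousLinearMap.ext fun v => by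
        simp only [add_apply, hC, map_add]
      map_smul' := fun c w => ContinuousLinearMap.ext fun v => by
        simp only [smul_apply, hC, map_smul, RingHom.id_apply] }, hC⟩

variable {E : Type*} [NormedAddCommGroup E] [NormedSpace ℝ E]
  {M : Type*} [TopologicalSpace M] [ChartedSpace E M]

theorem DForm.d_zero : DForm.d (0 : DForm E M F k) = 0 := by
  funext x
  have extDeriv_zero (y : E) : extDeriv (fun _ : E => (0 : E [⋀^Fin k]→L[ℝ] F)) y = 0 := by
    rw [extDeriv, fderiv_fun_const]
    exact (ContinuousAlternatingMap.alternatizeUncurryFinCLM ℝ E F).map_zero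
  exact congrArg (fun β : E [⋀^Fin (k + 1)]→L[ℝ] F => β.compContinuousLinearMap (chartDeriv x x))
    (extDeriv_zero _)

theorem mapsTo_d_of_forall_eq_bot [IsManifold 𝓘(ℝ, E) ∞ M] {R : Type*} [Semiring R] [Module R F]
    [ContinuousConstSMul R F] [SMulCommClass ℝ R F]
    {S : ∀ x : M, Submodule R (TangentSpace 𝓘(ℝ, E) x [⋀^Fin k]→L[ℝ] F)}
    {T : ∀ x : M, Submodule R (TangentSpace 𝓘(ℝ, E) x [⋀^Fin (k + 1)]→L[ℝ] F)}
    (hS : ∀ x, S x = ⊥) : MapsTo DForm.d (smoothSections S) (smoothSections T) := by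
  rintro α ⟨smooth, mem⟩
  have α_eq_zero : α = 0 := funext fun x => (Submodule.eq_bot_iff _).1 (hS x) _ (mem x)
  refine ⟨smooth.d, fun x => ?_⟩
  rw [α_eq_zero, DForm.d_zero]
  exact zero_mem _

theorem d_mem_of_dimension_one [IsManifold 𝓘(ℝ, E) 1 M] {Q : Sp1GLStructure E M 1} (hr : 0 ≤ r)
    {α : DForm E M F k} (hα : ∀ x, α x ∈ casimirBundle Q F k r x) (x : M) :
    DForm.d α x ∈ casimirBundle Q F (k + 1) (r + 1) x ⊔ casimirBundle Q F (k + 1) (r - 1) x := by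
  by_cases hα₀ : α = 0
  · rw [hα₀, DForm.d_zero]
    exact zero_mem _
  · obtain ⟨y, hy⟩ := Function.ne_iff.1 hα₀
    obtain ⟨p, hp⟩ := exists_mem_frames Q x
    obtain ⟨q, hq⟩ := exists_mem_frames Q y
    refine mem_casimirBundle_sup hp (mem_casimirSpace_sup_of_ne_zero hr (hα y q hq) ?_ _)
    intro comp_eq_zero
    refine hy (ContinuousAlternatingMap.ext fun v => ?_)
    simpa [Function.comp_def] using congrArg (fun β => β (q ∘ v)) comp_eq_zero

theorem disjoint_bundleC [IsManifold 𝓘(ℝ, E) 1 M] (Q : Sp1GLStructure E M n) (k : ℕ) (r : ℤ)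
    (x : M) : Disjoint (bundleC Q k (r + 1) x) (bundleC Q k (r - 1) x) := by
  rcases lt_or_ge r 0 with hr | hr
  · rw [bundleC_eq_bot (by omega : r - 1 < 0)]
    exact disjoint_bot_right
  · have h : Disjoint ((bundleC Q k (r + 1) x).restrictScalars ℝ)
        ((bundleC Q k (r - 1) x).restrictScalars ℝ) := by
      rw [restrictScalars_bundleC (by omega), restrictScalars_bundleC (by omega)]
      exact disjoint_casimirBundle (by omega) (by omega) x
    exact Submodule.disjoint_def.2 fun α => Submodule.disjoint_def.1 h α

theorem disjoint_bundleR [IsManifold 𝓘(ℝ, E) 1 M] (Q : Sp1GLStructure E M n) (k : ℕ) (r : ℤ)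
    (x : M) : Disjoint (bundleR Q k (r + 1) x) (bundleR Q k (r - 1) x) := by
  rcases lt_or_ge r 0 with hr | hr
  · rw [bundleR_eq_bot (by omega : r - 1 < 0)]
    exact disjoint_bot_right
  · rw [bundleR_eq_casimirBundle (by omega), bundleR_eq_casimirBundle (by omega)]
    exact disjoint_casimirBundle (by omega) (by omega) x

variable [FiniteDimensional ℝ E] [CompleteSpace E] [IsManifold 𝓘(ℝ, E) ∞ M]
  {Q : Sp1GLStructure E M n}

theorem d_mem_of_admitsTorsionFreeConnection (hQ : AdmitsTorsionFreeConnection Q) (hr : r ≠ -1)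
    {α : DForm E M F k} (hα : α.IsSmooth) (hαQ : ∀ x, α x ∈ casimirBundle Q F k r x) (x : M) :
    DForm.d α x ∈ casimirBundle Q F (k + 1) (r + 1) x ⊔ casimirBundle Q F (k + 1) (r - 1) x := by
  obtain ⟨cov, -, torsion_eq_zero, preserves⟩ := hQ
  obtain ⟨U, s, hU, hxU, hsQ, hs⟩ := Q.exists_section x
  have hf (w : Fin n → ℍ[ℝ]) := preserves U s hU hsQ hs x hxU ((s x).symm w)
  obtain ⟨A, hA⟩ := exists_clm_of_mem_sp1glAlgebra hf
    (fun w w' v => by simp only [map_add]) (fun c w v => by simp only [map_smul])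
  have differentiable (v : Fin n → ℍ[ℝ]) : MDifferentiableAt 𝓘(ℝ, E) 𝓘(ℝ, E).tangent
      (fun p => (⟨p, (s p).symm v⟩ : TangentBundle 𝓘(ℝ, E) M)) x :=
    ((hs v).contMDiffAt (hU.mem_nhds hxU)).mdifferentiableAt (by simp)
  have components_mem : ∀ᶠ p in 𝓝 x, (α.val p).compContinuousLinearMap (frameInv s p) ∈
      casimirSpace (leftMulHom n) r := by
    filter_upwards [hU.mem_nhds hxU] with p hp using hαQ p (s p) (hsQ p hp)
  obtain ⟨T, hT, d_eq⟩ := exists_d_comp_frameInv (A := A) hα torsion_eq_zero differentiable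
    (fun w v => by
      rw [hA]
      exact (s x).symm_apply_apply _)
    (isClosed_casimirSpace _ _)
    (fun w γ hγ => lieDer_mem_casimirSpace_of_mem_sp1glAlgebra (by rw [hA]; exact hf w) hγ)
    components_mem
  exact mem_casimirBundle_sup (hsQ x hxU) <|
    d_eq.symm ▸ alternatizeUncurryFin_mem_sup (leftMulHom n) hr hT

theorem mapsTo_d_casimirBundle (hn : 1 ≤ n) (hQ : 2 ≤ n → AdmitsTorsionFreeConnection Q)
    (hr : 0 ≤ r) :
    MapsTo DForm.d (smoothSections (casimirBundle Q F k r)) (smoothSections fun x =>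
      casimirBundle Q F (k + 1) (r + 1) x ⊔ casimirBundle Q F (k + 1) (r - 1) x) := by
  refine fun α hα => ⟨hα.1.d, ?_⟩
  rcases hn.eq_or_lt with rfl | hn
  · exact d_mem_of_dimension_one hr hα.2
  · exact d_mem_of_admitsTorsionFreeConnection (hQ hn) (by omega) hα.1 hα.2

theorem mapsTo_d_bundleC (hn : 1 ≤ n) (hQ : 2 ≤ n → AdmitsTorsionFreeConnection Q) (k : ℕ)
    (r : ℤ) :
    MapsTo DForm.d (smoothSections (bundleC Q k r))
      (smoothSections fun x => bundleC Q (k + 1) (r + 1) x ⊔ bundleC Q (k + 1) (r - 1) x) := by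
  rcases lt_or_ge r 0 with hr | hr
  · exact mapsTo_d_of_forall_eq_bot (bundleC_eq_bot hr)
  · rintro α ⟨smooth, mem⟩
    have d_mem := mapsTo_d_casimirBundle hn hQ hr ⟨smooth, fun x => by
      rw [← restrictScalars_bundleC (by omega)]
      exact mem x⟩
    refine ⟨d_mem.1, fun x => ?_⟩
    rw [← Submodule.restrictScalars_mem ℝ, Submodule.restrictScalars_sup,
      restrictScalars_bundleC (by omega), restrictScalars_bundleC (by omega)]
    exact d_mem.2 x

theorem mapsTo_d_bundleR (hn : 1 ≤ n) (hQ : 2 ≤ n → AdmitsTorsionFreeConnection Q) (k : ℕ)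
    (r : ℤ) :
    MapsTo DForm.d (smoothSections (bundleR Q k r))
      (smoothSections fun x => bundleR Q (k + 1) (r + 1) x ⊔ bundleR Q (k + 1) (r - 1) x) := by
  rcases lt_or_ge r 0 with hr | hr
  · exact mapsTo_d_of_forall_eq_bot (bundleR_eq_bot hr)
  · have eq_casimirBundle {k : ℕ} {s : ℤ} (hs : -1 ≤ s) : bundleR Q k s = casimirBundle Q ℝ k s :=
      funext (bundleR_eq_casimirBundle hs)
    rw [eq_casimirBundle (by omega), eq_casimirBundle (by omega), eq_casimirBundle (by omega)]
    exact mapsTo_d_casimirBundle hn hQ hr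

end Main

end

end QuatDolbeault

theorem theorem4p3 {E : Type*} [NormedAddCommGroup E] [NormedSpace ℝ E] [FiniteDimensional ℝ E]
    [CompleteSpace E] {M : Type*} [TopologicalSpace M] [ChartedSpace E M]
    [IsManifold 𝓘(ℝ, E) ∞ M] (n : ℕ) (hn : 1 ≤ n) (hE : Module.finrank ℝ E = 4 * n)
    (Q : QuatDolbeault.Sp1GLStructure E M n)
    (hQ : 2 ≤ n → QuatDolbeault.AdmitsTorsionFreeConnection Q) (k : ℕ) (r : ℤ) :
    -- complex-valued forms
    (Set.MapsTo QuatDolbeault.DForm.d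
        (QuatDolbeault.smoothSections (QuatDolbeault.bundleC Q k r))
        (QuatDolbeault.smoothSections fun x =>
          QuatDolbeault.bundleC Q (k + 1) (r + 1) x ⊔ QuatDolbeault.bundleC Q (k + 1) (r - 1) x) ∧
      ∀ x : M, Disjoint (QuatDolbeault.bundleC Q (k + 1) (r + 1) x)
        (QuatDolbeault.bundleC Q (k + 1) (r - 1) x)) ∧
    -- real-valued forms
    (Set.MapsTo QuatDolbeault.DForm.d
        (QuatDolbeault.smoothSections (QuatDolbeault.bundleR Q k r))
        (QuatDolbeault.smoothSections fun x =>
          QuatDolbeault.bundleR Q (k + 1) (r + 1) x ⊔ QuatDolbeault.bundleR Q (k + 1) (r - 1) x) ∧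
      ∀ x : M, Disjoint (QuatDolbeault.bundleR Q (k + 1) (r + 1) x)
        (QuatDolbeault.bundleR Q (k + 1) (r - 1) x)) := by
  exact
    ⟨⟨QuatDolbeault.mapsTo_d_bundleC hn hQ k r, QuatDolbeault.disjoint_bundleC Q (k + 1) r⟩,
      QuatDolbeault.mapsTo_d_bundleR hn hQ k r, QuatDolbeault.disjoint_bundleR Q (k + 1) r⟩
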